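/- Let $X$ be a finite set and $\mathcal F\subseteq 2^X$. In the strict $(1:b)$ Avoider–Enforcer game $\mathcal F$, Avoider (who plays first) and Enforcer alternately claim exactly $1$ and exactly $b$ previously unclaimed elements of $X$ per move; in the monotone $(1:b)$ game they claim at least $1$ and at least $b$, respectively. In both versions a player who faces fewer free elements than his bias claims all of them. The game ends when all elements are claimed; Avoider loses if he has claimed all elements of some $F\in\mathcal F$, and wins otherwise. With $b$ ranging over the positive integers, let $f^{mon}$ be the non-negative integer such that Enforcer wins the monotone $(1:b)$ game if and only if $b\le f^{mon}$; let $f^-$ be the largest non-negative integer such that Enforcer wins the strict $(1:b)$ game for every $b\le f^-$; and let $f^+$ be the smallest non-negative integer such that Avoider wins the strict $(1:b)$ game for every $b>f^+$. Fix an integer $k\ge 3$ and consider the $k$-star game, in which $X=E(K_n)$ and $\mathcal F$ consists of the edge sets of all copies of the star $K_{1,k}$ in $K_n$. For integers $n\ge 0$ and $b\ge1$ let $r(n,b)$ be the integer with $1\le r(n,b)\le b+1$ and $\binom n2\equiv r(n,b) \pmod{b+1}$, and let $$e^+_{n,k}=\max\Big\{b\ge 1:\ b\le 0.4\,n^{\frac{k}{k-1}},\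 r(n,b)<\frac{n^{k+1}}{(2b)^{k-1}}\Big\},$$ $$e^-_{n,k}=\max\Big\{b\ge 1:\ b\le 0.4\,n^{\frac{k}{k-1}},\ r(n,b')<\frac{n^{k+1}}{(2b')^{k-1}}\text{ for every }1\le b'\le b\Big\}.$$ Then $f^{mon}$, $f^+$ and $f^-$ exist for every $n$, $e^+_{n,k}$ and $e^-_{n,k}$ exist for all sufficiently large $n$, and, with all asymptotics taken as $n\to\infty$ and all implied constants depending only on $k$: (i) $f^{mon}=\Theta\big(n^{\frac{k}{k-1}}\big)$. (ii) $e^+_{n,k}\le f^+$ for all sufficiently large $n$, and $f^+=O\big(n^{\frac{k}{k-1}}\big)$; moreover, there is an infinite set of values of $n$ along which $f^+=\Theta\big(n^{\frac{k}{k-1}}\big)$. (iii) $e^-_{n,k}=\Omega\big(n^{\frac{k+1}{k}}\big)$, $e^-_{n,k}\le f^-$ for all sufficiently large $n$, and $f^-=O\big(n^{\frac{k+1}{k}}\log n\big)$; moreover, there is an infinite set of values of $n$ along which $f^-=\Theta\big(n^{\frac{k+1}{k}}\big)$. In particular, $f^-$ and $f^+$ are not of the same order: $f^-=\Theta(f^+)$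 (as $n\to\infty$) does not hold. -/

import Mathlib

open Filter Asymptotics

/-- The two sets of rules of an Avoider-Enforcer game: under the strict rules a player with bias
`a` claims exactly `a` free elements per move, under the monotone rules at least `a`. -/
inductive AERule where
  | strict
  | monotone

/-- `LegalMove rule a U S`: when `U` is the set of free elements, a player with bias `a` may claim
the set `S` in one move. If fewer than `a` elements are free, he has to claim all of them. -/
def LegalMove {α : Type*} (rule : AERule) (a : ℕ) (U S : Finset α) : Prop :=
  S ⊆ U ∧ match rule with
    | .strict => S.card = min a U.card
    | .monotone => min a U.card ≤ S.card

/-- Enforcer has a winning strategy in the `(a : b)` game with target sets `F`, from the position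
with Avoider to move in which Avoider has claimed `A` and the elements of `U` are free.
In `round`, `R S` is Enforcer's reply to Avoider's move `S`. -/
inductive EnforcerWinsFrom {α : Type*} [DecidableEq α] (rule : AERule) (a b : ℕ)
    (F : Set (Finset α)) : Finset α → Finset α → Prop
  | gameOver (A : Finset α) (T : Finset α) (hT : T ∈ F) (hTA : T ⊆ A) :
      EnforcerWinsFrom rule a b F A ∅
  | round (A U : Finset α) (hU : U.Nonempty) (R : Finset α → Finset α)
      (hR : ∀ S, LegalMove rule a U S → LegalMove rule b (U \ S) (R S))
      (hwin : ∀ S, LegalMove rule a U S →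
        EnforcerWinsFrom rule a b F (A ∪ S) ((U \ S) \ R S)) :
      EnforcerWinsFrom rule a b F A U

/-- Avoider has a winning strategy in the `(a : b)` game with target sets `F`, from the position
with Avoider to move in which Avoider has claimed `A` and the elements of `U` are free. -/
inductive AvoiderWinsFrom {α : Type*} [DecidableEq α] (rule : AERule) (a b : ℕ)
    (F : Set (Finset α)) : Finset α → Finset α → Prop
  | gameOver (A : Finset α) (hA : ∀ T ∈ F, ¬ T ⊆ A) : AvoiderWinsFrom rule a b F A ∅
  | round (A U : Finset α) (hU : U.Nonempty) (S : Finset α) (hS : LegalMove rule a U S)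
      (hwin : ∀ R, LegalMove rule b (U \ S) R →
        AvoiderWinsFrom rule a b F (A ∪ S) ((U \ S) \ R)) :
      AvoiderWinsFrom rule a b F A U

/-- Enforcer wins the `(a : b)` Avoider-Enforcer game on the board `X` with target sets `F`
(Avoider plays first). -/
def EnforcerWins {α : Type*} [DecidableEq α] (rule : AERule) (a b : ℕ) (X : Finset α)
    (F : Set (Finset α)) : Prop :=
  EnforcerWinsFrom rule a b F ∅ X

/-- Avoider wins the `(a : b)` Avoider-Enforcer game on the board `X` with target sets `F`
(Avoider plays first). -/
def AvoiderWins {α : Type*} [DecidableEq α] (rule : AERule) (a b : ℕ) (X : Finset α)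
    (F : Set (Finset α)) : Prop :=
  AvoiderWinsFrom rule a b F ∅ X

/-- The integers `m ≥ 0` such that Enforcer wins the strict `(1 : b)` game for every `b ≤ m`. -/
def lowerThresholdSet {α : Type*} [DecidableEq α] (X : Finset α) (F : Set (Finset α)) : Set ℕ :=
  {m | ∀ b : ℕ, 1 ≤ b → b ≤ m → EnforcerWins .strict 1 b X F}

/-- The integers `m ≥ 0` such that Avoider wins the strict `(1 : b)` game for every `b > m`. -/
def upperThresholdSet {α : Type*} [DecidableEq α] (X : Finset α) (F : Set (Finset α)) : Set ℕ :=
  {m | ∀ b : ℕ, m < b → AvoiderWins .strict 1 b X F}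

/-- The integers `m ≥ 0` such that Enforcer wins the monotone `(1 : b)` game iff `b ≤ m`. -/
def monotoneThresholdSet {α : Type*} [DecidableEq α] (X : Finset α) (F : Set (Finset α)) :
    Set ℕ :=
  {m | ∀ b : ℕ, 1 ≤ b → (EnforcerWins .monotone 1 b X F ↔ b ≤ m)}

/-- The board `E(K_n)`. -/
def edgesK (n : ℕ) : Finset (Sym2 (Fin n)) := (⊤ : SimpleGraph (Fin n)).edgeFinset

/-- The edge sets of the copies of the star `K_{1,k}` in `K_n`: `v` is the centre and `L` is the
set of leaves. -/
def starCopies (k n : ℕ) : Set (Finset (Sym2 (Fin n))) :=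
  {T | ∃ (v : Fin n) (L : Finset (Fin n)), v ∉ L ∧ L.card = k ∧ T = L.image fun u => s(v, u)}

/-- The lower threshold bias of the `k`-star game on `E(K_n)`. -/
noncomputable def fMinus (k n : ℕ) : ℕ := sSup (lowerThresholdSet (edgesK n) (starCopies k n))

/-- The upper threshold bias of the `k`-star game on `E(K_n)`. -/
noncomputable def fPlus (k n : ℕ) : ℕ := sInf (upperThresholdSet (edgesK n) (starCopies k n))

/-- The monotone threshold bias of the `k`-star game on `E(K_n)`. -/
noncomputable def fMon (k n : ℕ) : ℕ := sSup (monotoneThresholdSet (edgesK n) (starCopies k n))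

/-- The integer `r` with `1 ≤ r ≤ b + 1` and `n.choose 2 ≡ r` modulo `b + 1`. -/
def lastRemainder (n b : ℕ) : ℕ := (n.choose 2 + b) % (b + 1) + 1

theorem lastRemainder_spec (n b : ℕ) :
    1 ≤ lastRemainder n b ∧ lastRemainder n b ≤ b + 1 ∧
      n.choose 2 ≡ lastRemainder n b [MOD b + 1] := by
  refine ⟨Nat.succ_le_succ (Nat.zero_le _), Nat.mod_lt _ (Nat.succ_pos b), ?_⟩
  have h : n.choose 2 + b + 1 ≡ lastRemainder n b [MOD b + 1] :=
    ((Nat.mod_modEq (n.choose 2 + b) (b + 1)).symm).add_right 1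
  have h' : n.choose 2 + b + 1 ≡ n.choose 2 [MOD b + 1] := by
    rw [add_assoc]
    exact Nat.add_modEq_right
  exact h'.symm.trans h

/-- The set whose maximum is `e⁺_{n,k}`. -/
def ePlusSet (k n : ℕ) : Set ℕ :=
  {b | 1 ≤ b ∧ (b : ℝ) ≤ 0.4 * (n : ℝ) ^ ((k : ℝ) / ((k : ℝ) - 1)) ∧
    (lastRemainder n b : ℝ) < (n : ℝ) ^ (k + 1) / (2 * (b : ℝ)) ^ (k - 1)}

/-- The set whose maximum is `e⁻_{n,k}`. -/
def eMinusSet (k n : ℕ) : Set ℕ :=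
  {b | 1 ≤ b ∧ (b : ℝ) ≤ 0.4 * (n : ℝ) ^ ((k : ℝ) / ((k : ℝ) - 1)) ∧
    ∀ b' : ℕ, 1 ≤ b' → b' ≤ b →
      (lastRemainder n b' : ℝ) < (n : ℝ) ^ (k + 1) / (2 * (b' : ℝ)) ^ (k - 1)}

noncomputable def ePlus (k n : ℕ) : ℕ := sSup (ePlusSet k n)

noncomputable def eMinus (k n : ℕ) : ℕ := sSup (eMinusSet k n)

/-! Avoider always takes a free edge whose larger endpoint degree is smallest. Then he creates a
vertex of degree j + 1 only when every free edge meets a vertex of degree at least j. So few edges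
are free, few rounds remain, and each adds at most two such vertices. Iterating this (`degBound`),
before his last move at most on the order of n^k / b^(k-1) vertices have degree k - 1, and they meet
on the order of n^(k+1) / b^(k-1) edges. He is safe if more edges than that are free whenever he
moves (`avoiderWins_of_degBound`). This holds when b is a large multiple of n^(k/(k-1)), and in the
strict game already when b is a large multiple of n^((k+1)/k) and the last remainder r is at least
half of b + 1.

Enforcer arranges free edges in rows, each owned by a vertex, and gives a vertex of degree d in
Avoider's graph the weight lam^d, where lam - 1 bounds the number of rows he can delete in one move.
He deletes rows of lowest degree, so the loss is at most (lam - 1) * lam^d for the degree d of any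
surviving row, and Avoider's next edge repays it. Hence the weight after each move of Avoider stays
at least M while the rows die out. When at most r edges are free, too few rows are left to carry M
with degrees below k, so a star exists (`RowPosition.enforcerWinsFrom`). Since the size of a move is
prescribed, partial rows cannot be avoided: the leftover is spread thinly over L rows, which are
deleted in the next move unless their vertex has gained degree. So every row is cut only boundedly
often and stays nearly complete.

A fixed bipartite board (`enforcerWins_of_rows`) suffices for the monotone game, where Enforcer can
force r = 1, and for strict biases of order n. The condition on r that defines the numbers `ePlus`
and `eMinus` needs rows of length close to n, obtained by first growing a dead set
(`enforcerWins_of_growth`).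

Finally, for every large n some bias of order n^(k/(k-1)) has remainder below n, and some bias of
order n^((k+1)/k) has remainder at least half of b + 1. So both strict thresholds have their exact
order along all n: the logarithm is not needed, and both infinite sets can be all of ℕ. -/

/-! ### General facts about Avoider-Enforcer games -/

section Game

variable {α : Type*} {rule : AERule} {a b : ℕ} {F : Set (Finset α)}

theorem LegalMove.min_le_card {U S : Finset α} (h : LegalMove rule a U S) :
    min a U.card ≤ S.card := by
  cases rule with
  | strict => exact h.2.ge
  | monotone => exact h.2

theorem legalMove_of_card_eq {U S : Finset α} (hS : S ⊆ U) (h : S.card = min a U.card) :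
    LegalMove rule a U S := by
  cases rule with
  | strict => exact ⟨hS, h⟩
  | monotone => exact ⟨hS, h.ge⟩

theorem exists_legalMove (rule : AERule) (a : ℕ) (U : Finset α) : ∃ S, LegalMove rule a U S := by
  obtain ⟨S, hS, hc⟩ := Finset.exists_subset_card_eq (min_le_right a U.card)
  exact ⟨S, legalMove_of_card_eq hS hc⟩

theorem LegalMove.nonempty {U S : Finset α} (h : LegalMove rule a U S) (ha : 1 ≤ a)
    (hU : U.Nonempty) : S.Nonempty := by
  rw [← Finset.card_pos] at hU ⊢
  have := h.min_le_card
  omega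

variable [DecidableEq α]

theorem AvoiderWinsFrom.not_enforcerWinsFrom {A U : Finset α}
    (h : AvoiderWinsFrom rule a b F A U) : ¬ EnforcerWinsFrom rule a b F A U := by
  induction h with
  | gameOver A hA =>
    intro hE
    cases hE with
    | gameOver _ T hT hTA => exact hA T hT hTA
    | round _ _ hU _ _ _ => simp at hU
  | round A U hU S hS hwin ih =>
    intro hE
    cases hE with
    | gameOver _ T hT hTA => simp at hU
    | round _ _ hU R hR hwin' => exact ih (R S) (hR S hS) (hwin' S hS)

/-- An invariant of the positions with Avoider to move that Enforcer can keep until Avoider has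
claimed a target set gives a winning strategy. -/
theorem enforcerWinsFrom_of_invariant (ha : 1 ≤ a) (Inv : Finset α → Finset α → Prop)
    (hlost : ∀ A U, (∃ T ∈ F, T ⊆ A) → EnforcerWinsFrom rule a b F A U)
    (hne : ∀ A U, Inv A U → U.Nonempty)
    (hstep : ∀ A U S, Inv A U → LegalMove rule a U S → (¬ ∃ T ∈ F, T ⊆ A ∪ S) →
      ∃ R, LegalMove rule b (U \ S) R ∧
        (Inv (A ∪ S) ((U \ S) \ R) ∨ EnforcerWinsFrom rule a b F (A ∪ S) ((U \ S) \ R)))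
    {A U : Finset α} (h : Inv A U) : EnforcerWinsFrom rule a b F A U := by
  classical
  induction hm : U.card using Nat.strong_induction_on generalizing A U with
  | _ m ih =>
    have hU := hne A U h
    have key : ∀ S, LegalMove rule a U S → ∃ R, LegalMove rule b (U \ S) R ∧
        EnforcerWinsFrom rule a b F (A ∪ S) ((U \ S) \ R) := by
      intro S hS
      by_cases hl : ∃ T ∈ F, T ⊆ A ∪ S
      · obtain ⟨R, hR⟩ := exists_legalMove rule b (U \ S)
        exact ⟨R, hR, hlost _ _ hl⟩
      · obtain ⟨R, hR, hI | hE⟩ := hstep A U S h hS hl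
        · refine ⟨R, hR, ih _ ?_ hI rfl⟩
          have h1 : ((U \ S) \ R).card ≤ (U \ S).card := Finset.card_le_card Finset.sdiff_subset
          have h2 := Finset.card_sdiff_of_subset hS.1
          have h3 := (hS.nonempty ha hU).card_pos
          have h4 := hU.card_pos
          omega
        · exact ⟨R, hR, hE⟩
    choose! R hR hW using key
    exact .round A U hU R hR hW

theorem enforcerWinsFrom_of_subset (ha : 1 ≤ a) {A U : Finset α} (h : ∃ T ∈ F, T ⊆ A) :
    EnforcerWinsFrom rule a b F A U := by
  classical
  induction hm : U.card using Nat.strong_induction_on generalizing A U with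
  | _ m ih =>
    rcases U.eq_empty_or_nonempty with rfl | hU
    · obtain ⟨T, hT, hTA⟩ := h
      exact .gameOver A T hT hTA
    · choose R hR using exists_legalMove (α := α) rule b
      refine .round A U hU (fun S => R (U \ S)) (fun S _ => hR _) (fun S hS => ih _ ?_ ?_ rfl)
      · have h1 : ((U \ S) \ R (U \ S)).card ≤ (U \ S).card :=
          Finset.card_le_card Finset.sdiff_subset
        have h2 := Finset.card_sdiff_of_subset hS.1
        have h3 := (hS.nonempty ha hU).card_pos
        have h4 := hU.card_pos
        omega
      · obtain ⟨T, hT, hTA⟩ := h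
        exact ⟨T, hT, hTA.trans Finset.subset_union_left⟩

/-- The same replies stay legal when fewer edges are demanded. This is why a single threshold
describes the monotone game. -/
theorem EnforcerWinsFrom.monotone_anti {b' : ℕ} (hb : b' ≤ b) {A U : Finset α}
    (h : EnforcerWinsFrom .monotone a b F A U) : EnforcerWinsFrom .monotone a b' F A U := by
  induction h with
  | gameOver A T hT hTA => exact .gameOver A T hT hTA
  | round A U hU R hR hwin ih =>
    exact .round A U hU R
      (fun S hS => ⟨(hR S hS).1, (min_le_min_right _ hb).trans (hR S hS).2⟩) ih

theorem avoiderWinsFrom_of_invariant (ha : 1 ≤ a) (Inv : Finset α → Finset α → Prop)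
    (hend : ∀ A, Inv A ∅ → ∀ T ∈ F, ¬ T ⊆ A)
    (hstep : ∀ A U, Inv A U → U.Nonempty → ∃ S, LegalMove rule a U S ∧
      ∀ R, LegalMove rule b (U \ S) R → Inv (A ∪ S) ((U \ S) \ R))
    {A U : Finset α} (h : Inv A U) : AvoiderWinsFrom rule a b F A U := by
  induction hm : U.card using Nat.strong_induction_on generalizing A U with
  | _ m ih =>
    rcases U.eq_empty_or_nonempty with rfl | hU
    · exact .gameOver A (hend A h)
    · obtain ⟨S, hS, hR⟩ := hstep A U h hU
      refine .round A U hU S hS fun R hR' => ih _ ?_ (hR R hR') rfl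
      have h1 : ((U \ S) \ R).card ≤ (U \ S).card := Finset.card_le_card Finset.sdiff_subset
      have h2 := Finset.card_sdiff_of_subset hS.1
      have h3 := (hS.nonempty ha hU).card_pos
      have h4 := hU.card_pos
      omega

end Game

/-! ### Degrees and stars -/

section Degree

variable {V : Type*} [DecidableEq V]

/-- The number of edges of `A` at the vertex `v`. -/
def edgeDeg (A : Finset (Sym2 V)) (v : V) : ℕ := (A.filter (v ∈ ·)).card

theorem edgeDeg_mono {A B : Finset (Sym2 V)} (h : A ⊆ B) (v : V) : edgeDeg A v ≤ edgeDeg B v :=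
  Finset.card_le_card (Finset.filter_subset_filter _ h)

theorem edgeDeg_union_of_disjoint {A B : Finset (Sym2 V)} (h : Disjoint A B) (v : V) :
    edgeDeg (A ∪ B) v = edgeDeg A v + edgeDeg B v := by
  rw [edgeDeg, Finset.filter_union, Finset.card_union_of_disjoint]
  · rfl
  · exact Finset.disjoint_filter_filter h

@[simp] theorem edgeDeg_empty (v : V) : edgeDeg (∅ : Finset (Sym2 V)) v = 0 := by
  simp [edgeDeg]

theorem edgeDeg_pos {A : Finset (Sym2 V)} {v : V} : 0 < edgeDeg A v ↔ ∃ e ∈ A, v ∈ e := by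
  simp [edgeDeg, Finset.card_pos, Finset.Nonempty]

end Degree

theorem mem_edgesK {n : ℕ} {e : Sym2 (Fin n)} : e ∈ edgesK n ↔ ¬ e.IsDiag := by
  induction e with
  | _ x y => simp [edgesK]

theorem mk_mem_edgesK {n : ℕ} {x y : Fin n} : s(x, y) ∈ edgesK n ↔ x ≠ y := by
  simp [mem_edgesK]

theorem card_edgesK (n : ℕ) : (edgesK n).card = n.choose 2 := by
  rw [edgesK, SimpleGraph.card_edgeFinset_top_eq_card_choose_two, Fintype.card_fin]

theorem edgeDeg_le {n : ℕ} (A : Finset (Sym2 (Fin n))) (v : Fin n) :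
    edgeDeg A v ≤ n := by
  have : A.filter (v ∈ ·) ⊆ (Finset.univ : Finset (Fin n)).image (fun u => s(v, u)) := by
    intro e he
    obtain ⟨_, hv⟩ := Finset.mem_filter.1 he
    obtain ⟨u, rfl⟩ := Sym2.mem_iff_exists.1 hv
    simp
  calc edgeDeg A v ≤ _ := Finset.card_le_card this
    _ ≤ _ := Finset.card_image_le
    _ = n := by simp

theorem exists_star_subset {k n : ℕ} {A : Finset (Sym2 (Fin n))} (hA : A ⊆ edgesK n) {v : Fin n}
    (hv : k ≤ edgeDeg A v) : ∃ T ∈ starCopies k n, T ⊆ A := by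
  classical
  set N : Finset (Fin n) := Finset.univ.filter fun u => s(v, u) ∈ A with hN
  have hinj : Function.Injective fun u : Fin n => s(v, u) := fun x y h =>
    Sym2.congr_right.1 h
  have himg : A.filter (v ∈ ·) = N.image fun u => s(v, u) := by
    ext e
    constructor
    · intro he
      obtain ⟨h1, hv⟩ := Finset.mem_filter.1 he
      obtain ⟨u, rfl⟩ := Sym2.mem_iff_exists.1 hv
      exact Finset.mem_image.2 ⟨u, by simp [hN, h1], rfl⟩
    · intro he
      obtain ⟨u, hu, rfl⟩ := Finset.mem_image.1 he
      simp only [hN, Finset.mem_filter] at hu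
      simp [hu.2]
  have hcard : N.card = edgeDeg A v := by
    rw [edgeDeg, himg, Finset.card_image_of_injective _ hinj]
  obtain ⟨L, hL, hLc⟩ := Finset.exists_subset_card_eq (hcard ▸ hv)
  refine ⟨L.image fun u => s(v, u), ⟨v, L, ?_, hLc, rfl⟩, ?_⟩
  · intro hvL
    have := hL hvL
    simp only [hN, Finset.mem_filter] at this
    exact mk_mem_edgesK.1 (hA this.2) rfl
  · intro e he
    obtain ⟨u, hu, rfl⟩ := Finset.mem_image.1 he
    have := hL hu
    simp only [hN, Finset.mem_filter] at this
    exact this.2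

theorem le_edgeDeg_of_star_subset {k n : ℕ} {A T : Finset (Sym2 (Fin n))}
    (hT : T ∈ starCopies k n) (hTA : T ⊆ A) : ∃ v, k ≤ edgeDeg A v := by
  classical
  obtain ⟨v, L, _, hc, rfl⟩ := hT
  have hinj : Function.Injective fun u : Fin n => s(v, u) := fun x y h =>
    Sym2.congr_right.1 h
  refine ⟨v, ?_⟩
  rw [← hc, ← Finset.card_image_of_injective L hinj]
  refine Finset.card_le_card fun e he => Finset.mem_filter.2 ⟨hTA he, ?_⟩
  obtain ⟨u, _, rfl⟩ := Finset.mem_image.1 he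
  simp

theorem card_le_of_edgeDeg_le {n d : ℕ} {A : Finset (Sym2 (Fin n))} (h : ∀ v, edgeDeg A v ≤ d) :
    A.card ≤ n * d := by
  classical
  have : A ⊆ (Finset.univ : Finset (Fin n)).biUnion fun v => A.filter (v ∈ ·) := by
    intro e he
    induction e with
    | _ x y => exact Finset.mem_biUnion.2 ⟨x, Finset.mem_univ _, by simp [he]⟩
  calc A.card ≤ _ := Finset.card_le_card this
    _ ≤ _ := Finset.card_biUnion_le_card_mul _ _ d fun v _ => h v
    _ = n * d := by simp

/-! ### Avoider's strategy -/

/-- The number of vertices of degree at least `j`. -/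
def numDegGE {n : ℕ} (A : Finset (Sym2 (Fin n))) (j : ℕ) : ℕ :=
  (Finset.univ.filter fun v => j ≤ edgeDeg A v).card

/-- Up to a factor `2`, bounds on the numbers of vertices of degree at least `j + 1` that Avoider
is forced to create before his last move. -/
def degBound (n q : ℕ) : ℕ → ℕ
  | 0 => n.choose 2 / q
  | j + 1 => 2 * n * degBound n q j / q

theorem degBound_mul_pow_le (n q j : ℕ) :
    degBound n q j * q ^ (j + 1) ≤ (2 * n) ^ j * n.choose 2 := by
  induction j with
  | zero => simpa [degBound] using Nat.div_mul_le_self (n.choose 2) q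
  | succ j ih =>
    calc degBound n q (j + 1) * q ^ (j + 1 + 1)
        = (2 * n * degBound n q j / q * q) * q ^ (j + 1) := by rw [degBound]; ring
      _ ≤ (2 * n * degBound n q j) * q ^ (j + 1) :=
          Nat.mul_le_mul_right _ (Nat.div_mul_le_self _ _)
      _ = 2 * n * (degBound n q j * q ^ (j + 1)) := by ring
      _ ≤ 2 * n * ((2 * n) ^ j * n.choose 2) := Nat.mul_le_mul_left _ ih
      _ = (2 * n) ^ (j + 1) * n.choose 2 := by ring

section Avoider

variable {n : ℕ}

theorem edgeDeg_insert_le (A : Finset (Sym2 (Fin n))) (e : Sym2 (Fin n)) (v : Fin n) :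
    edgeDeg (A ∪ {e}) v ≤ edgeDeg A v + if v ∈ e then 1 else 0 := by
  rw [edgeDeg, Finset.filter_union]
  refine (Finset.card_union_le _ _).trans (Nat.add_le_add_left ?_ _)
  split_ifs with h <;> simp [Finset.filter_singleton, h]

theorem card_filter_mem_sym2_le (e : Sym2 (Fin n)) :
    (Finset.univ.filter fun v => v ∈ e).card ≤ 2 := by
  induction e with
  | _ x y =>
    have : (Finset.univ.filter fun v => v ∈ s(x, y)) ⊆ {x, y} := by
      intro v hv
      simpa using hv
    exact (Finset.card_le_card this).trans Finset.card_le_two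

theorem numDegGE_insert_le (A : Finset (Sym2 (Fin n))) (e : Sym2 (Fin n)) (j : ℕ) :
    numDegGE (A ∪ {e}) j ≤ numDegGE A j + 2 := by
  classical
  have : (Finset.univ.filter fun v => j ≤ edgeDeg (A ∪ {e}) v) ⊆
      (Finset.univ.filter fun v => j ≤ edgeDeg A v) ∪ (Finset.univ.filter fun v => v ∈ e) := by
    intro v hv
    simp only [Finset.mem_filter, Finset.mem_univ, true_and, Finset.mem_union] at hv ⊢
    have := edgeDeg_insert_le A e v
    by_contra! h
    rw [if_neg h.2] at this
    omega
  exact (Finset.card_le_card this).trans ((Finset.card_union_le _ _).trans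
    (Nat.add_le_add_left (card_filter_mem_sym2_le e) _))

theorem numDegGE_insert_eq (A : Finset (Sym2 (Fin n))) (e : Sym2 (Fin n)) (j : ℕ)
    (h : ∀ v ∈ e, edgeDeg A v < j) :
    numDegGE (A ∪ {e}) (j + 1) ≤ numDegGE A (j + 1) := by
  refine Finset.card_le_card fun v hv => ?_
  simp only [Finset.mem_filter, Finset.mem_univ, true_and] at hv ⊢
  have := edgeDeg_insert_le A e v
  split_ifs at this with h'
  · have := h v h'
    omega
  · omega

theorem card_le_numDegGE_mul (A U : Finset (Sym2 (Fin n))) (j : ℕ)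
    (h : ∀ e ∈ U, ∃ v ∈ e, j ≤ edgeDeg A v) : U.card ≤ numDegGE A j * n := by
  classical
  have : U ⊆ (Finset.univ.filter fun v => j ≤ edgeDeg A v).biUnion fun v => U.filter (v ∈ ·) := by
    intro e he
    obtain ⟨v, hv, hj⟩ := h e he
    exact Finset.mem_biUnion.2 ⟨v, by simpa using hj, by simp [he, hv]⟩
  exact (Finset.card_le_card this).trans
    (Finset.card_biUnion_le_card_mul _ _ n fun v _ => edgeDeg_le U v)

/-- Avoider can choose a free edge whose maximal degree is smallest: if one endpoint has degree at
least `j`, then all free edges have an endpoint of degree at least `j`. -/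
theorem exists_min_edge (A U : Finset (Sym2 (Fin n))) (hU : U.Nonempty) :
    ∃ e ∈ U, ∀ j, (∃ v ∈ e, j ≤ edgeDeg A v) → ∀ e' ∈ U, ∃ v ∈ e', j ≤ edgeDeg A v := by
  classical
  obtain ⟨e, he, hmin⟩ := Finset.exists_min_image U
    (fun e => (Finset.univ.filter fun v => v ∈ e).sup (edgeDeg A)) hU
  refine ⟨e, he, fun j ⟨v, hv, hj⟩ e' he' => ?_⟩
  have h1 : j ≤ (Finset.univ.filter fun v => v ∈ e).sup (edgeDeg A) :=
    hj.trans (Finset.le_sup (f := edgeDeg A) (by simpa using hv))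
  have h2 := h1.trans (hmin e' he')
  have hne : (Finset.univ.filter fun v => v ∈ e').Nonempty := by
    induction e' with
    | _ x y => exact ⟨x, by simp⟩
  obtain ⟨w, hw, hw'⟩ := Finset.exists_mem_eq_sup _ hne (edgeDeg A)
  exact ⟨w, by simpa using hw, by omega⟩

/-- `G` describes the possible numbers of free edges at Avoider's turns and `r` is a lower bound for
the positive ones. A first vertex of degree k could only appear when all free edges meet the
vertices of degree k - 1, which cover fewer than `r` edges. -/
theorem avoiderWins_of_degBound {k b r : ℕ} {rule : AERule} (hk : 2 ≤ k) (G : ℕ → Prop)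
    (hG0 : G (n.choose 2)) (hGr : ∀ g, G g → 0 < g → r ≤ g)
    (hGstep : ∀ g x, G g → 0 < g → min b (g - 1) ≤ x → x ≤ g - 1 →
      (rule = .strict → x = min b (g - 1)) → G (g - 1 - x))
    (hr : 2 * n * degBound n (b + 1) (k - 2) < r) :
    AvoiderWins rule 1 b (edgesK n) (starCopies k n) := by
  classical
  -- The rounded-up quotient u / (b + 1) bounds the number of rounds still to be played.
  let ρ : ℕ → ℕ := fun u => (u + b) / (b + 1)
  -- The subtraction is truncated: while more than `degBound n (b + 1) j + 1` rounds may remain,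
  -- there is no vertex of degree j + 1 at all. Afterwards two may appear per round. As ρ ≥ 1 at
  -- Avoider's turn, at most twice `degBound` exist then.
  let Inv : Finset (Sym2 (Fin n)) → Finset (Sym2 (Fin n)) → Prop := fun A U =>
    G U.card ∧ ρ U.card ≤ degBound n (b + 1) 0 + 1 ∧
    (∀ j, j + 2 ≤ k → numDegGE A (j + 1) ≤ 2 * (degBound n (b + 1) j + 1 - ρ U.card)) ∧
    numDegGE A k = 0
  have ρle : ∀ u, ρ u ≤ u / (b + 1) + 1 := by
    intro u
    have h := Nat.div_add_mod u (b + 1)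
    have h1 := Nat.mod_lt u (Nat.succ_pos b)
    refine Nat.lt_succ_iff.1 ((Nat.div_lt_iff_lt_mul (Nat.succ_pos b)).2 ?_)
    simp only [Nat.succ_eq_add_one] at *
    nlinarith
  have hz : ∀ j, numDegGE (∅ : Finset (Sym2 (Fin n))) (j + 1) = 0 := by
    intro j
    simp [numDegGE]
  refine avoiderWinsFrom_of_invariant le_rfl Inv ?_ ?_ ?_
  · rintro A ⟨-, -, -, h⟩ T hT hTA
    obtain ⟨v, hv⟩ := le_edgeDeg_of_star_subset hT hTA
    have : 0 < numDegGE A k := Finset.card_pos.2 ⟨v, by simpa using hv⟩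
    omega
  · rintro A U ⟨hG, hρ0, hd, hdk⟩ hU
    obtain ⟨e, he, hmin⟩ := exists_min_edge A U hU
    have hUc := hU.card_pos
    refine ⟨{e}, legalMove_of_card_eq (by simpa using he) (by simp; omega), fun R hR => ?_⟩
    have hc1 : (U \ {e}).card = U.card - 1 := by
      rw [Finset.card_sdiff_of_subset (by simpa using he), Finset.card_singleton]
    have hc2 : ((U \ {e}) \ R).card = U.card - 1 - R.card := by
      rw [Finset.card_sdiff_of_subset hR.1, hc1]
    have hRmin := hR.min_le_card
    have hRle := Finset.card_le_card hR.1
    rw [hc1] at hRmin hRle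
    have hρ' : ρ (U.card - 1 - R.card) + 1 ≤ ρ U.card := by
      by_cases hb : b ≤ U.card - 1
      · have : U.card + b = (U.card - 1 - b + b) + (b + 1) := by omega
        have h1 : ρ U.card = ρ (U.card - 1 - b) + 1 := by
          simp only [ρ]
          rw [this, Nat.add_div_right _ (Nat.succ_pos b)]
        rw [h1]
        refine Nat.succ_le_succ (Nat.div_le_div_right ?_)
        omega
      · have h0 : U.card - 1 - R.card = 0 := by omega
        rw [h0]
        have h1 : ρ 0 = 0 := Nat.div_eq_of_lt (by omega)
        rw [h1]
        exact (Nat.le_div_iff_mul_le (Nat.succ_pos b)).2 (by omega)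
    refine ⟨?_, ?_, ?_, ?_⟩
    · rw [hc2]
      refine hGstep _ _ hG hUc hRmin hRle ?_
      rintro rfl
      simpa [hc1] using hR.2
    · rw [hc2]; omega
    · intro j hj
      rw [hc2]
      by_cases hcase : ∃ v ∈ e, j ≤ edgeDeg A v
      · have h1 := numDegGE_insert_le A e (j + 1)
        have h2 := hd j hj
        -- A vertex of degree j is used only if all free edges meet such vertices. Counting these
        -- edges bounds the remaining rounds, so the truncated difference really drops and pays for
        -- the two new vertices.
        have h3 : ρ U.card ≤ degBound n (b + 1) j + 1 := by
          cases j with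
          | zero => exact hρ0
          | succ j =>
            have h4 := card_le_numDegGE_mul A U (j + 1) (hmin _ hcase)
            have h5 := hd j (by omega)
            refine (ρle _).trans (Nat.succ_le_succ (Nat.div_le_div_right ?_))
            have h6 : 1 ≤ ρ U.card := by omega
            have h7 : numDegGE A (j + 1) ≤ 2 * degBound n (b + 1) j := by omega
            nlinarith
        omega
      · push Not at hcase
        have h1 := numDegGE_insert_eq A e j hcase
        have h2 := hd j hj
        omega
    · by_contra hpos
      have hcase : ∃ v ∈ e, k - 1 ≤ edgeDeg A v := by
        by_contra! hcase
        have h1 := numDegGE_insert_eq A e (k - 1) hcase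
        rw [Nat.sub_add_cancel (by omega)] at h1
        omega
      have h4 := card_le_numDegGE_mul A U (k - 1) (hmin _ hcase)
      have h5 := hd (k - 2) (by omega)
      have h6 : 1 ≤ ρ U.card := by omega
      rw [show k - 2 + 1 = k - 1 by omega] at h5
      have h7 : numDegGE A (k - 1) ≤ 2 * degBound n (b + 1) (k - 2) := by omega
      have h8 := hGr _ hG hUc
      nlinarith
  · refine ⟨by rwa [card_edgesK], by rw [card_edgesK]; exact ρle _, fun j _ => ?_, ?_⟩
    · rw [hz]; exact Nat.zero_le _
    · obtain ⟨j, rfl⟩ := Nat.exists_eq_add_of_le' (show 1 ≤ k by omega)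
      exact hz j

/-- Here no vertex of degree k - 1 exists before the last move, so one free edge at that time is
enough and the rules do not matter. -/
theorem avoiderWins_of_degBound_eq_zero {k b : ℕ} (rule : AERule) (hk : 2 ≤ k)
    (h : degBound n (b + 1) (k - 2) = 0) : AvoiderWins rule 1 b (edgesK n) (starCopies k n) :=
  avoiderWins_of_degBound hk (r := 1) (fun _ => True) trivial (fun _ _ h => h)
    (fun _ _ _ _ _ _ _ => trivial) (by simp [h])

theorem exists_choose_two_eq_lastRemainder_add {b : ℕ} (hn : 2 ≤ n) :
    ∃ i, n.choose 2 = lastRemainder n b + i * (b + 1) := by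
  obtain ⟨h1, h2, h3⟩ := lastRemainder_spec n b
  have hpos : 0 < n.choose 2 := Nat.choose_pos hn
  have hle : lastRemainder n b ≤ n.choose 2 := by
    by_contra! hlt
    rw [Nat.modEq_iff_dvd' hlt.le] at h3
    have := Nat.le_of_dvd (by omega) h3
    omega
  obtain ⟨i, hi⟩ := (Nat.modEq_iff_dvd' hle).1 h3.symm
  exact ⟨i, by rw [mul_comm]; omega⟩

/-- In the strict game, the last remainder is a lower bound on the number of free edges. -/
theorem avoiderWins_strict_of_degBound_lt {k b : ℕ} (hk : 2 ≤ k) (hn : 2 ≤ n)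
    (h : 2 * n * degBound n (b + 1) (k - 2) < lastRemainder n b) :
    AvoiderWins .strict 1 b (edgesK n) (starCopies k n) := by
  refine avoiderWins_of_degBound hk
    (fun g => g = 0 ∨ ∃ i, g = lastRemainder n b + i * (b + 1))
    (Or.inr (exists_choose_two_eq_lastRemainder_add hn)) ?_ ?_ h
  · rintro g (rfl | ⟨i, rfl⟩) hg
    · omega
    · omega
  · rintro g x hg hg0 - - hx
    rw [hx rfl]
    have := (lastRemainder_spec n b).2.1
    rcases hg with rfl | ⟨i, rfl⟩
    · omega
    · rcases i with _ | i
      · left; omega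
      · right
        refine ⟨i, ?_⟩
        rw [add_mul]
        omega

end Avoider

/-! ### Enforcer's strategy on a board partitioned into rows

Every free edge `e` belongs to the row of one of its endpoints `own e`. Enforcer claims whole rows
of the vertices of lowest degree in Avoider's graph, and spreads what is left of his move evenly
over several other rows. -/

section Rows

variable {n : ℕ}

/-- The number of edges of `U` in the row of `v`. -/
def rowCard (own : Sym2 (Fin n) → Fin n) (U : Finset (Sym2 (Fin n))) (v : Fin n) : ℕ :=
  (U.filter (own · = v)).card

/-- The total weight of the rows in `Z`, where a vertex of degree `d` has weight `lam ^ d`. -/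
def rowWeight (lam : ℕ) (A : Finset (Sym2 (Fin n))) (Z : Finset (Fin n)) : ℕ :=
  ∑ v ∈ Z, lam ^ edgeDeg A v

/-- The rows in `Z` are nearly complete. Those in `P` have been reduced in the last move, and their
vertices are of lowest degree. -/
structure RowBalanced (own : Sym2 (Fin n) → Fin n) (k L D h : ℕ) (A U : Finset (Sym2 (Fin n)))
    (Z P : Finset (Fin n)) (c : ℕ) : Prop where
  subset : P ⊆ Z
  card_le : P.card ≤ L
  level_le : c ≤ k
  le_deg : ∀ v ∈ Z, v ∉ P → c ≤ edgeDeg A v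
  le_row : ∀ v ∈ Z, v ∉ P → h ≤ rowCard own U v + (edgeDeg A v + c) * (D + 1)
  deg_le : ∀ v ∈ P, edgeDeg A v ≤ c
  le_deg_succ : ∀ v ∈ P, c ≤ edgeDeg A v + 1
  le_row' : ∀ v ∈ P, h + 1 ≤ rowCard own U v + (edgeDeg A v + 1 + c) * (D + 1)

/-- The numerical assumptions under which Enforcer's strategy works: rows have between `h₁` and `H`
edges, in each move Enforcer claims at most `B` edges, he reduces at most `L` rows by at most `D`
edges each, and `M` is the total weight that he maintains until at most `r` edges are free. -/
structure RowParams (k L D H h h₁ lam M B r : ℕ) : Prop where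
  H_le : H ≤ L * D
  D_le : D ≤ h₁
  pos : 1 ≤ h₁
  h_le : h₁ + 2 * k * (D + 1) ≤ h
  B_le : B ≤ (lam - 1) * h₁
  one_le_lam : 1 ≤ lam
  final : ∀ m, (m - 1) * h₁ < r → m * lam ^ (k - 1) < M

theorem card_filter_own_mem (own : Sym2 (Fin n) → Fin n) (U : Finset (Sym2 (Fin n)))
    (K : Finset (Fin n)) : (U.filter (own · ∈ K)).card = ∑ v ∈ K, rowCard own U v := by
  rw [Finset.card_eq_sum_card_fiberwise (f := own) (t := K)]
  · refine Finset.sum_congr rfl fun v hv => ?_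
    rw [rowCard, Finset.filter_filter]
    congr 1
    ext e
    simp only [Finset.mem_filter, and_congr_right_iff]
    intro _
    constructor
    · exact fun h => h.2
    · rintro rfl
      exact ⟨hv, rfl⟩
  · intro e he
    simpa using (Finset.mem_filter.1 he).2

/-- The losses of a row are charged in units of D + 1 to the degree of its vertex and to the level
c. Together these make at most 2k units, even with the extra unit of a row in `P`. -/
theorem RowBalanced.le_rowCard {own : Sym2 (Fin n) → Fin n} {k L D H h h₁ lam M B r : ℕ}
    (hp : RowParams k L D H h h₁ lam M B r) {A U : Finset (Sym2 (Fin n))}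
    {Z P : Finset (Fin n)} {c : ℕ} (hb : RowBalanced own k L D h A U Z P c)
    (hk : ∀ v, edgeDeg A v < k) {v : Fin n} (hv : v ∈ Z) : h₁ ≤ rowCard own U v := by
  have h1 := hk v
  have h2 := hb.level_le
  have h3 := hp.h_le
  have key : ∀ x, x ≤ 2 * k → x * (D + 1) ≤ 2 * k * (D + 1) :=
    fun x hx => Nat.mul_le_mul_right _ hx
  by_cases hP : v ∈ P
  · have h4 := hb.le_row' v hP
    have h5 := key (edgeDeg A v + 1 + c) (by omega)
    omega
  · have h4 := hb.le_row v hv hP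
    have h5 := key (edgeDeg A v + c) (by omega)
    omega

/-- If Avoider claims the edges of `S`, then the rows that lose an edge belong to vertices whose
degree grows. -/
theorem RowBalanced.move {own : Sym2 (Fin n) → Fin n} {k L D h : ℕ} {A U S : Finset (Sym2 (Fin n))}
    {Z P : Finset (Fin n)} {c : ℕ} (hb : RowBalanced own k L D h A U Z P c)
    (hown : ∀ e ∈ U, own e ∈ e) (hAS : Disjoint A S) :
    RowBalanced own k L D h (A ∪ S) (U \ S) Z
      (P.filter fun v => edgeDeg (A ∪ S) v = edgeDeg A v) c := by
  have hdeg : ∀ v, edgeDeg (A ∪ S) v = edgeDeg A v + edgeDeg S v :=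
    edgeDeg_union_of_disjoint hAS
  have hrow : ∀ v, rowCard own U v ≤ rowCard own (U \ S) v + edgeDeg S v := by
    intro v
    have : U.filter (own · = v) ⊆ (U \ S).filter (own · = v) ∪ S.filter (v ∈ ·) := by
      intro e he
      obtain ⟨h1, h2⟩ := Finset.mem_filter.1 he
      by_cases heS : e ∈ S
      · exact Finset.mem_union_right _ (Finset.mem_filter.2 ⟨heS, h2 ▸ hown e h1⟩)
      · exact Finset.mem_union_left _ (Finset.mem_filter.2 ⟨Finset.mem_sdiff.2 ⟨h1, heS⟩, h2⟩)
    exact (Finset.card_le_card this).trans (Finset.card_union_le _ _)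
  refine ⟨(Finset.filter_subset _ _).trans hb.subset,
    (Finset.card_le_card (Finset.filter_subset _ _)).trans hb.card_le, hb.level_le, ?_, ?_, ?_,
    ?_, ?_⟩
  · intro v hv hvP
    by_cases hP : v ∈ P
    · have h1 := hb.le_deg_succ v hP
      have h2 : edgeDeg (A ∪ S) v ≠ edgeDeg A v := fun h => hvP (Finset.mem_filter.2 ⟨hP, h⟩)
      have h3 := hdeg v
      omega
    · have h1 := hb.le_deg v hv hP
      have h3 := hdeg v
      omega
  · intro v hv hvP
    have h3 := hdeg v
    have h4 := hrow v
    rw [h3]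
    -- A row that leaves `P` does so because its degree grew, and the growth absorbs the extra unit.
    -- A unit is D + 1 instead of D because Avoider's own edge may come from the row as well.
    by_cases hP : v ∈ P
    · have h1 := hb.le_row' v hP
      have h2 : edgeDeg (A ∪ S) v ≠ edgeDeg A v := fun h => hvP (Finset.mem_filter.2 ⟨hP, h⟩)
      obtain ⟨s, hs⟩ : ∃ s, edgeDeg S v = s + 1 := ⟨edgeDeg S v - 1, by omega⟩
      rw [hs] at h4 ⊢
      nlinarith
    · have h1 := hb.le_row v hv hP
      nlinarith
  · intro v hv
    obtain ⟨h1, h2⟩ := Finset.mem_filter.1 hv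
    rw [h2]
    exact hb.deg_le v h1
  · intro v hv
    obtain ⟨h1, h2⟩ := Finset.mem_filter.1 hv
    rw [h2]
    exact hb.le_deg_succ v h1
  · intro v hv
    obtain ⟨h1, h2⟩ := Finset.mem_filter.1 hv
    have h3 := hdeg v
    have h4 := hrow v
    have h5 := hb.le_row' v h1
    rw [h2]
    have : edgeDeg S v = 0 := by omega
    omega

/-- Enforcer's reply: he claims `β` edges. Either few rows remain, or the remaining rows are
balanced. -/
theorem RowBalanced.exists_reply {own : Sym2 (Fin n) → Fin n} {k L D H h h₁ lam M B r : ℕ}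
    (hp : RowParams k L D H h h₁ lam M B r) {A U : Finset (Sym2 (Fin n))}
    {Z K₀ : Finset (Fin n)} {c β : ℕ} (hb : RowBalanced own k L D h A U Z K₀ c)
    (hk : ∀ v, edgeDeg A v < k) (hown : ∀ e ∈ U, own e ∈ Z) (hH : ∀ v, rowCard own U v ≤ H)
    (hM : M ≤ rowWeight lam A Z) (hK₀ : ∑ v ∈ K₀, rowCard own U v ≤ β) (hβB : β ≤ B)
    (hβ : β < U.card) (hu : U.card - β ≤ r ∨ L * H ≤ U.card - β) :
    ∃ R ⊆ U, R.card = β ∧ ∃ Z', (∀ e ∈ U \ R, own e ∈ Z') ∧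
      (∀ v ∈ Z', M ≤ rowWeight lam A Z' + (lam - 1) * lam ^ edgeDeg A v) ∧
      (Z'.card * lam ^ (k - 1) < M ∨
        r < U.card - β ∧ ∃ P c', RowBalanced own k L D h A (U \ R) Z' P c') := by
  classical
  -- `K` is a largest set of rows that fits into the move, is closed downwards in degree, and
  -- contains the rows `K₀` cut in the last move. `K₀` itself is a candidate: its degrees are at
  -- most c and all others at least c.
  obtain ⟨K, hKmem, hKmax⟩ := Finset.exists_max_image
    (Z.powerset.filter fun K => K₀ ⊆ K ∧ (∀ x ∈ K, ∀ y ∈ Z, y ∉ K → edgeDeg A x ≤ edgeDeg A y) ∧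
      ∑ v ∈ K, rowCard own U v ≤ β) Finset.card ⟨K₀, by
        simp only [Finset.mem_filter, Finset.mem_powerset]
        exact ⟨hb.subset, subset_rfl,
          fun x hx y hy hy' => (hb.deg_le x hx).trans (hb.le_deg y hy hy'), hK₀⟩⟩
  simp only [Finset.mem_filter, Finset.mem_powerset] at hKmem hKmax
  obtain ⟨hKZ, hK₀K, hKlow, hKβ⟩ := hKmem
  have hrow : ∀ v ∈ Z, h₁ ≤ rowCard own U v := fun v hv => hb.le_rowCard hp hk hv
  have hUcard : ∀ J : Finset (Fin n), (U.filter (own · ∈ J)).card + (U.filter (own · ∉ J)).card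
      = U.card := fun J => Finset.card_filter_add_card_filter_not _
  have hKc := card_filter_own_mem own U K
  have hUK := hUcard K
  -- the rows outside `K`
  set Z' := Z \ K with hZ'
  have hUZ' : U.filter (own · ∉ K) = U.filter (own · ∈ Z') := by
    ext e
    simp only [Finset.mem_filter, hZ', Finset.mem_sdiff, and_congr_right_iff]
    exact fun he => ⟨fun h => ⟨hown e he, h⟩, fun h => h.2⟩
  have hZ'c : (U.filter (own · ∉ K)).card = ∑ v ∈ Z', rowCard own U v := by
    rw [hUZ', card_filter_own_mem]
  have hZ'ne : Z'.Nonempty := by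
    by_contra hne
    rw [Finset.not_nonempty_iff_eq_empty] at hne
    rw [hne, Finset.sum_empty] at hZ'c
    omega
  obtain ⟨p, hpZ', hpmin⟩ := Finset.exists_min_image Z' (edgeDeg A) hZ'ne
  have hpZ : p ∈ Z := (Finset.mem_sdiff.1 hpZ').1
  have hpK : p ∉ K := (Finset.mem_sdiff.1 hpZ').2
  -- By maximality the next lowest row does not fit, so the leftover of the move is less than one
  -- row.
  have hKp : β < ∑ v ∈ K, rowCard own U v + rowCard own U p := by
    by_contra! hle
    have := hKmax (insert p K) ⟨Finset.insert_subset hpZ hKZ, hK₀K.trans (Finset.subset_insert _ _),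
      ?_, ?_⟩
    · rw [Finset.card_insert_of_notMem hpK] at this
      omega
    · intro x hx y hy hyK
      rw [Finset.mem_insert, not_or] at hyK
      rcases Finset.mem_insert.1 hx with rfl | hx
      · exact hpmin y (Finset.mem_sdiff.2 ⟨hy, hyK.2⟩)
      · exact hKlow x hx y hy hyK.2
    · rw [Finset.sum_insert hpK]
      omega
  have hKcard : K.card ≤ lam - 1 := by
    have h1 : K.card * h₁ ≤ ∑ v ∈ K, rowCard own U v := by
      rw [← smul_eq_mul]
      exact Finset.card_nsmul_le_sum _ _ _ fun v hv => hrow v (hKZ hv)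
    exact Nat.le_of_mul_le_mul_right ((h1.trans hKβ).trans (hβB.trans hp.B_le)) hp.pos
  -- At most lam - 1 rows are deleted, none of degree above that of a surviving v.
  have hpromise : ∀ v ∈ Z', M ≤ rowWeight lam A Z' + (lam - 1) * lam ^ edgeDeg A v := by
    intro v hv
    obtain ⟨hvZ, hvK⟩ := Finset.mem_sdiff.1 hv
    have h1 : rowWeight lam A Z = rowWeight lam A Z' + rowWeight lam A K :=
      (Finset.sum_sdiff hKZ).symm
    have h2 : rowWeight lam A K ≤ K.card * lam ^ edgeDeg A v := by
      rw [← smul_eq_mul]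
      exact Finset.sum_le_card_nsmul _ _ _ fun x hx =>
        Nat.pow_le_pow_right hp.one_le_lam (hKlow x hx v hvZ hvK)
    have h3 := Nat.mul_le_mul_right (lam ^ edgeDeg A v) hKcard
    omega
  -- completing the rows in `K` to a legal move
  have pack : ∀ T ⊆ U.filter (own · ∉ K), T.card = β - ∑ v ∈ K, rowCard own U v →
      U.filter (own · ∈ K) ∪ T ⊆ U ∧ (U.filter (own · ∈ K) ∪ T).card = β ∧
      ∀ e ∈ U \ (U.filter (own · ∈ K) ∪ T), own e ∈ Z' := by
    intro T hT hTc
    refine ⟨Finset.union_subset (Finset.filter_subset _ _) (hT.trans (Finset.filter_subset _ _)),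
      ?_, ?_⟩
    · rw [Finset.card_union_of_disjoint, hKc, hTc]
      · omega
      · refine Finset.disjoint_left.2 fun e he he' => ?_
        exact (Finset.mem_filter.1 (hT he')).2 (Finset.mem_filter.1 he).2
    · intro e he
      simp only [Finset.mem_sdiff, Finset.mem_union, Finset.mem_filter, not_or, not_and] at he
      exact Finset.mem_sdiff.2 ⟨hown e he.1, he.2.1 he.1⟩
  rcases le_or_gt (U.card - β) r with hu' | hu'
  · -- few edges remain
    obtain ⟨T, hT, hTc⟩ := Finset.exists_subset_card_eq
      (show β - ∑ v ∈ K, rowCard own U v ≤ (U.filter (own · ∉ K)).card by omega)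
    obtain ⟨h1, h2, h3⟩ := pack T hT hTc
    refine ⟨_, h1, h2, Z', h3, hpromise, Or.inl (hp.final _ ?_)⟩
    -- The leftover is smaller than the row of p, so the other rows together have fewer edges than
    -- the number that stays free, which is at most r.
    have h4 : (Z'.card - 1) * h₁ + rowCard own U p ≤ ∑ v ∈ Z', rowCard own U v := by
      rw [← Finset.sum_erase_add _ _ hpZ', ← Finset.card_erase_of_mem hpZ', ← smul_eq_mul]
      exact Nat.add_le_add_right (Finset.card_nsmul_le_sum _ _ _ fun v hv =>
        hrow v (Finset.mem_sdiff.1 (Finset.mem_of_mem_erase hv)).1) _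
    omega
  · -- many edges remain
    replace hu : L * H ≤ U.card - β := by omega
    have hZ'L : L ≤ Z'.card := by
      have h1 : ∑ v ∈ Z', rowCard own U v ≤ Z'.card * H := by
        rw [← smul_eq_mul]
        exact Finset.sum_le_card_nsmul _ _ _ fun v _ => hH v
      have h2 : L * H ≤ Z'.card * H := by omega
      have h3 : 0 < H := hp.pos.trans ((hrow p hpZ).trans (hH p))
      exact Nat.le_of_mul_le_mul_right h2 h3
    -- the edges taken from the rows in `S`
    have shave : ∀ S ⊆ Z', S.card = L → ∃ T ⊆ U.filter (own · ∉ K),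
        T.card = β - ∑ v ∈ K, rowCard own U v ∧
        (∀ v ∈ Z', rowCard own U v ≤ rowCard own (U \ (U.filter (own · ∈ K) ∪ T)) v + D) ∧
        (∀ v ∈ Z', v ∉ S →
          rowCard own U v ≤ rowCard own (U \ (U.filter (own · ∈ K) ∪ T)) v) := by
      intro S hS hSc
      have hE : ∀ v ∈ S, ∃ E ⊆ U.filter (own · = v), E.card = D := fun v hv =>
        Finset.exists_subset_card_eq
          (hp.D_le.trans (hrow v (Finset.mem_sdiff.1 (hS hv)).1))
      choose! E hEsub hEc using hE
      have hbU : (S.biUnion E).card = L * D := by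
        rw [Finset.card_biUnion, Finset.sum_congr rfl hEc, Finset.sum_const, hSc, smul_eq_mul]
        intro x hx y hy hxy
        refine Finset.disjoint_left.2 fun e he he' => hxy ?_
        rw [← (Finset.mem_filter.1 (hEsub x hx he)).2, (Finset.mem_filter.1 (hEsub y hy he')).2]
      have hpH := hH p
      have hHL := hp.H_le
      obtain ⟨T, hT, hTc⟩ := Finset.exists_subset_card_eq
        (show β - ∑ v ∈ K, rowCard own U v ≤ (S.biUnion E).card by omega)
      have hTown : ∀ e ∈ T, e ∈ U ∧ own e ∈ S ∧ e ∈ E (own e) := by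
        intro e he
        obtain ⟨v, hv, hev⟩ := Finset.mem_biUnion.1 (hT he)
        obtain ⟨h1, rfl⟩ := Finset.mem_filter.1 (hEsub v hv hev)
        exact ⟨h1, hv, hev⟩
      have hsub : ∀ v ∈ Z', U.filter (own · = v) ⊆
          (U \ (U.filter (own · ∈ K) ∪ T)).filter (own · = v) ∪ T.filter (own · = v) := by
        intro v hv e he
        obtain ⟨h1, h2⟩ := Finset.mem_filter.1 he
        by_cases heT : e ∈ T
        · exact Finset.mem_union_right _ (Finset.mem_filter.2 ⟨heT, h2⟩)
        · refine Finset.mem_union_left _ (Finset.mem_filter.2 ⟨Finset.mem_sdiff.2 ⟨h1, ?_⟩, h2⟩)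
          rw [Finset.mem_union, not_or]
          refine ⟨fun h => (Finset.mem_sdiff.1 hv).2 ?_, heT⟩
          exact h2 ▸ (Finset.mem_filter.1 h).2
      refine ⟨T, ?_, hTc, ?_, ?_⟩
      · intro e he
        obtain ⟨h1, h2, -⟩ := hTown e he
        exact Finset.mem_filter.2 ⟨h1, (Finset.mem_sdiff.1 (hS h2)).2⟩
      · intro v hv
        refine (Finset.card_le_card (hsub v hv)).trans ((Finset.card_union_le _ _).trans
          (Nat.add_le_add_left ?_ _))
        by_cases hvS : v ∈ S
        · rw [← hEc v hvS]
          refine Finset.card_le_card fun e he => ?_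
          obtain ⟨h1, rfl⟩ := Finset.mem_filter.1 he
          exact (hTown e h1).2.2
        · rw [Finset.filter_eq_empty_iff.2]
          · simp
          · rintro e he rfl
            exact hvS (hTown e he).2.1
      · intro v hv hvS
        refine Finset.card_le_card fun e he => ?_
        rcases Finset.mem_union.1 (hsub v hv he) with h | h
        · exact h
        · obtain ⟨h1, rfl⟩ := Finset.mem_filter.1 h
          exact absurd (hTown e h1).2.1 hvS
    have hcp : c ≤ edgeDeg A p := hb.le_deg p hpZ fun h => hpK (hK₀K h)
    have hZ'K₀ : ∀ v ∈ Z', v ∈ Z ∧ v ∉ K₀ := fun v hv =>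
      ⟨(Finset.mem_sdiff.1 hv).1, fun h => (Finset.mem_sdiff.1 hv).2 (hK₀K h)⟩
    have hold : ∀ v ∈ Z', h ≤ rowCard own U v + (edgeDeg A v + edgeDeg A p) * (D + 1) := by
      intro v hv
      refine (hb.le_row v (hZ'K₀ v hv).1 (hZ'K₀ v hv).2).trans ?_
      gcongr
    -- With L rows of lowest degree, only such rows are cut, and they form the new `P`. Otherwise
    -- arbitrary L rows are cut and the level rises by one, which charges every row. The fewer than
    -- L lowest rows then become `P`, so that the remaining degrees reach the new level.
    by_cases hG : L ≤ (Z'.filter fun v => edgeDeg A v = edgeDeg A p).card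
    · obtain ⟨S, hS, hSc⟩ := Finset.exists_subset_card_eq hG
      obtain ⟨T, hT, hTc, hTD, hT0⟩ := shave S (hS.trans (Finset.filter_subset _ _)) hSc
      obtain ⟨h1, h2, h3⟩ := pack T hT hTc
      refine ⟨_, h1, h2, Z', h3, hpromise, Or.inr ⟨hu', S, edgeDeg A p, ?_⟩⟩
      have hSd : ∀ v ∈ S, v ∈ Z' ∧ edgeDeg A v = edgeDeg A p := fun v hv =>
        Finset.mem_filter.1 (hS hv)
      refine ⟨hS.trans (Finset.filter_subset _ _), hSc.le, (hk p).le, fun v hv _ => hpmin v hv,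
        fun v hv hvS => ?_, fun v hv => (hSd v hv).2.le, fun v hv => ?_, fun v hv => ?_⟩
      · have h4 := hT0 v hv hvS
        have h5 := hold v hv
        omega
      · have h4 := (hSd v hv).2
        omega
      · have h4 := hTD v (hSd v hv).1
        have h5 := hold v (hSd v hv).1
        have h6 : (edgeDeg A v + 1 + edgeDeg A p) * (D + 1) =
          (edgeDeg A v + edgeDeg A p) * (D + 1) + (D + 1) := by ring
        omega
    · obtain ⟨S, hS, hSc⟩ := Finset.exists_subset_card_eq hZ'L
      obtain ⟨T, hT, hTc, hTD, -⟩ := shave S hS hSc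
      obtain ⟨h1, h2, h3⟩ := pack T hT hTc
      refine ⟨_, h1, h2, Z', h3, hpromise, Or.inr
        ⟨hu', Z'.filter fun v => edgeDeg A v = edgeDeg A p, edgeDeg A p + 1, ?_⟩⟩
      have hnew : ∀ v ∈ Z', h + 1 ≤ rowCard own (U \ (U.filter (own · ∈ K) ∪ T)) v +
          (edgeDeg A v + (edgeDeg A p + 1)) * (D + 1) := by
        intro v hv
        have h4 := hTD v hv
        have h5 := hold v hv
        have h6 : (edgeDeg A v + (edgeDeg A p + 1)) * (D + 1) =
          (edgeDeg A v + edgeDeg A p) * (D + 1) + (D + 1) := by ring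
        omega
      refine ⟨Finset.filter_subset _ _, by omega, hk p, fun v hv hv' => ?_, fun v hv _ => ?_,
        fun v hv => ?_, fun v hv => ?_, fun v hv => ?_⟩
      · have h4 := hpmin v hv
        have h5 : edgeDeg A v ≠ edgeDeg A p := fun h => hv' (Finset.mem_filter.2 ⟨hv, h⟩)
        omega
      · have := hnew v hv
        omega
      · have := (Finset.mem_filter.1 hv).2
        omega
      · have := (Finset.mem_filter.1 hv).2
        omega
      · have h4 := hnew v (Finset.mem_filter.1 hv).1
        have h5 : (edgeDeg A v + 1 + (edgeDeg A p + 1)) * (D + 1) =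
          (edgeDeg A v + (edgeDeg A p + 1)) * (D + 1) + (D + 1) := by ring
        omega

/-- The way in which Enforcer chooses the sizes of his moves: if `u` edges are free, then he claims
`β u` of them. The numbers of free edges that Avoider faces satisfy `G`. -/
structure EnforcerPlan (rule : AERule) (b lo cap B r : ℕ) (β : ℕ → ℕ) (G : ℕ → Prop) : Prop where
  min_le : ∀ u, min b u ≤ β u
  strict : rule = .strict → ∀ u, β u = min b u
  step : ∀ g a, G g → r < g → 1 ≤ a → a ≤ cap → a ≤ g → (rule = .strict → a = 1) →
    lo ≤ β (g - a) ∧ β (g - a) ≤ B ∧ β (g - a) < g - a ∧ G (g - a - β (g - a)) ∧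
      (g - a - β (g - a) ≤ r ∨ lo ≤ g - a - β (g - a))

theorem EnforcerPlan.legalMove {rule : AERule} {b lo cap B r : ℕ} {β : ℕ → ℕ} {G : ℕ → Prop}
    (hplan : EnforcerPlan rule b lo cap B r β G) {α : Type*} {U R : Finset α} (hR : R ⊆ U)
    (hc : R.card = β U.card) : LegalMove rule b U R := by
  cases rule with
  | strict => exact ⟨hR, hc.trans (hplan.strict rfl _)⟩
  | monotone => exact ⟨hR, hc ▸ hplan.min_le _⟩

/-- The gain from lam^d to lam^(d+1) is exactly the deficit that Enforcer's deletion may leave. -/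
theorem rowWeight_add_le {lam : ℕ} {A A' : Finset (Sym2 (Fin n))} {Z : Finset (Fin n)} {v : Fin n}
    (hlam : 1 ≤ lam) (hA : A ⊆ A') (hv : v ∈ Z) (hd : edgeDeg A v < edgeDeg A' v) :
    rowWeight lam A Z + (lam - 1) * lam ^ edgeDeg A v ≤ rowWeight lam A' Z := by
  rw [rowWeight, rowWeight, ← Finset.sum_erase_add _ _ hv,
    ← Finset.sum_erase_add Z (fun v => lam ^ edgeDeg A' v) hv]
  have h1 : ∑ x ∈ Z.erase v, lam ^ edgeDeg A x ≤ ∑ x ∈ Z.erase v, lam ^ edgeDeg A' x :=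
    Finset.sum_le_sum fun x _ => Nat.pow_le_pow_right hlam (edgeDeg_mono hA x)
  have h2 : lam ^ (edgeDeg A v + 1) ≤ lam ^ edgeDeg A' v := Nat.pow_le_pow_right hlam hd
  obtain ⟨l, rfl⟩ := Nat.exists_eq_add_of_le' hlam
  rw [pow_succ] at h2
  simp only [Nat.add_sub_cancel]
  nlinarith

theorem edgeDeg_lt_of_not_star {k : ℕ} {A : Finset (Sym2 (Fin n))} (hA : A ⊆ edgesK n)
    (h : ¬ ∃ T ∈ starCopies k n, T ⊆ A) (v : Fin n) : edgeDeg A v < k := by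
  by_contra! hv
  exact h (exists_star_subset hA hv)

theorem edgeDeg_lt_union {A S : Finset (Sym2 (Fin n))} (h : Disjoint A S) {e : Sym2 (Fin n)}
    (he : e ∈ S) {v : Fin n} (hv : v ∈ e) : edgeDeg A v < edgeDeg (A ∪ S) v := by
  rw [edgeDeg_union_of_disjoint h]
  exact Nat.lt_add_of_pos_right (edgeDeg_pos.2 ⟨e, he, hv⟩)

/-- A position, with Avoider to move, in which Enforcer can follow the strategy on rows. -/
structure RowPosition (own : Sym2 (Fin n) → Fin n) (k L D H h lam M r : ℕ) (G : ℕ → Prop)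
    (A U : Finset (Sym2 (Fin n))) (Z : Finset (Fin n)) : Prop where
  subset_left : A ⊆ edgesK n
  subset_right : U ⊆ edgesK n
  disjoint : Disjoint A U
  nonempty : U.Nonempty
  good : G U.card
  own_mem : ∀ e ∈ U, own e ∈ e
  own_mem' : ∀ e ∈ U, own e ∈ Z
  rowCard_le : ∀ v, rowCard own U v ≤ H
  weight : ∀ v ∈ Z, M ≤ rowWeight lam A Z + (lam - 1) * lam ^ edgeDeg A v
  balanced : Z.card * lam ^ (k - 1) < M ∨ r < U.card ∧ ∃ P c, RowBalanced own k L D h A U Z P c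

/-- Avoider's move restores the weight M. In a final position this contradicts degrees below k;
otherwise the reply on rows leads to another position of the same kind, with fewer free edges. -/
theorem RowPosition.enforcerWinsFrom {own : Sym2 (Fin n) → Fin n}
    {k b L D H h h₁ lam M B r : ℕ} {rule : AERule} {β : ℕ → ℕ} {G : ℕ → Prop}
    (hp : RowParams k L D H h h₁ lam M B r)
    (hplan : EnforcerPlan rule b (L * H) (n * k) B r β G) {A U : Finset (Sym2 (Fin n))}
    {Z : Finset (Fin n)} (hpos : RowPosition own k L D H h lam M r G A U Z) :
    EnforcerWinsFrom rule 1 b (starCopies k n) A U := by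
  classical
  refine enforcerWinsFrom_of_invariant le_rfl
    (fun A U => ∃ Z, RowPosition own k L D H h lam M r G A U Z)
    (fun A U => enforcerWinsFrom_of_subset le_rfl) (fun A U ⟨Z, h⟩ => h.nonempty) ?_ ⟨Z, hpos⟩
  rintro A U S ⟨Z, hI⟩ hS hl
  have hSU := hS.1
  have hAS : Disjoint A S := hI.disjoint.mono_right hSU
  have hA' : A ∪ S ⊆ edgesK n := Finset.union_subset hI.subset_left (hSU.trans hI.subset_right)
  have hdeg := edgeDeg_lt_of_not_star hA' hl
  have hSne := hS.nonempty le_rfl hI.nonempty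
  have hM : M ≤ rowWeight lam (A ∪ S) Z := by
    obtain ⟨e, he⟩ := hSne
    have hv := hI.own_mem' e (hSU he)
    exact (hI.weight _ hv).trans (rowWeight_add_le hp.one_le_lam Finset.subset_union_left hv
      (edgeDeg_lt_union hAS he (hI.own_mem e (hSU he))))
  rcases hI.balanced with hfin | ⟨hr, P, c, hb⟩
  · exfalso
    have h1 : rowWeight lam (A ∪ S) Z ≤ Z.card * lam ^ (k - 1) := by
      rw [← smul_eq_mul]
      exact Finset.sum_le_card_nsmul _ _ _ fun v _ =>
        Nat.pow_le_pow_right hp.one_le_lam (Nat.le_sub_one_of_lt (hdeg v))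
    omega
  -- In the monotone game Avoider may claim many edges at once, but without a star he never owns
  -- more than n * k.
  · have hScap : S.card ≤ n * k := (Finset.card_le_card Finset.subset_union_right).trans
      (card_le_of_edgeDeg_le fun v => (hdeg v).le)
    have hSc := Finset.card_le_card hSU
    have hUS : (U \ S).card = U.card - S.card := Finset.card_sdiff_of_subset hSU
    obtain ⟨h1, h2, h3, h4, h5⟩ := hplan.step U.card S.card hI.good hr hSne.card_pos hScap hSc
      (by
        rintro rfl
        have := hS.2
        have := hI.nonempty.card_pos
        simp only at *
        omega)
    rw [← hUS] at h1 h2 h3 h4 h5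
    have hb' := hb.move hI.own_mem hAS
    have hH' : ∀ v, rowCard own (U \ S) v ≤ H := fun v =>
      (Finset.card_le_card (Finset.filter_subset_filter _ Finset.sdiff_subset)).trans
        (hI.rowCard_le v)
    obtain ⟨R, hR, hRc, Z', hown', hw, hbal⟩ := hb'.exists_reply hp hdeg
      (fun e he => hI.own_mem' e (Finset.mem_sdiff.1 he).1) hH' hM
      (by
        refine le_trans ?_ h1
        refine (Finset.sum_le_card_nsmul _ _ H fun v _ => hH' v).trans ?_
        rw [smul_eq_mul]
        exact Nat.mul_le_mul_right _ hb'.card_le) h2 h3 h5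
    have hsub : (U \ S) \ R ⊆ U := Finset.sdiff_subset.trans Finset.sdiff_subset
    have hRcard : ((U \ S) \ R).card = (U \ S).card - β (U \ S).card := by
      rw [Finset.card_sdiff_of_subset hR, hRc]
    refine ⟨R, hplan.legalMove hR hRc, Or.inl ⟨Z', ⟨hA', hsub.trans hI.subset_right, ?_, ?_, ?_,
      fun e he => hI.own_mem e (hsub he), hown', fun v => ?_, hw, ?_⟩⟩⟩
    · rw [Finset.disjoint_union_left]
      exact ⟨hI.disjoint.mono_right hsub,
        Finset.disjoint_sdiff.mono_right Finset.sdiff_subset⟩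
    · rw [← Finset.card_pos]
      omega
    · rwa [hRcard]
    · exact (Finset.card_le_card (Finset.filter_subset_filter _ hsub)).trans (hI.rowCard_le v)
    · rwa [hRcard]

end Rows

/-! ### Starting from a fixed set of rows -/

section Static

variable {n : ℕ}

/-- Enforcer first spends all his moves outside `T`. The strategy on rows begins with the move for
which that supply is too small. Until then the rows have lost edges only to Avoider, and every row
contributes weight at least 1. -/
theorem enforcerWins_of_rows {own : Sym2 (Fin n) → Fin n}
    {k b L D H h h₁ lam M B r : ℕ} {rule : AERule} {β : ℕ → ℕ} {G : ℕ → Prop}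
    (hp : RowParams k L D H h h₁ lam M B r)
    (hplan : EnforcerPlan rule b (L * H) (n * k) B r β G) {T : Finset (Sym2 (Fin n))}
    {Z : Finset (Fin n)} (hT : T ⊆ edgesK n) (hG : G (n.choose 2)) (hown : ∀ e ∈ T, own e ∈ e)
    (hown' : ∀ e ∈ T, own e ∈ Z) (hH : ∀ v, rowCard own T v ≤ H)
    (hh : ∀ v ∈ Z, h ≤ rowCard own T v) (hM : M ≤ Z.card) (hTc : r + n * k < T.card) :
    EnforcerWins rule 1 b (edgesK n) (starCopies k n) := by
  classical
  refine enforcerWinsFrom_of_invariant le_rfl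
    (fun A U => A ⊆ edgesK n ∧ U ⊆ edgesK n ∧ Disjoint A U ∧ G U.card ∧ T ⊆ A ∪ U ∧ r < U.card)
    (fun A U => enforcerWinsFrom_of_subset le_rfl) (fun A U h => ?_) ?_ ?_
  · rw [← Finset.card_pos]
    omega
  · rintro A U S ⟨hA, hU, hAU, hGU, hTAU, hr⟩ hS hl
    have hSU := hS.1
    have hAS : Disjoint A S := hAU.mono_right hSU
    have hA' : A ∪ S ⊆ edgesK n := Finset.union_subset hA (hSU.trans hU)
    have hdeg := edgeDeg_lt_of_not_star hA' hl
    have hSne := hS.nonempty le_rfl (Finset.card_pos.1 (by omega))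
    have hAcap : (A ∪ S).card ≤ n * k := card_le_of_edgeDeg_le fun v => (hdeg v).le
    have hScap : S.card ≤ n * k := (Finset.card_le_card Finset.subset_union_right).trans hAcap
    have hSc := Finset.card_le_card hSU
    have hUS : (U \ S).card = U.card - S.card := Finset.card_sdiff_of_subset hSU
    obtain ⟨h1, h2, h3, h4, h5⟩ := hplan.step U.card S.card hGU hr hSne.card_pos hScap hSc
      (by
        rintro rfl
        have := hS.2
        simp only at *
        omega)
    rw [← hUS] at h1 h2 h3 h4 h5
    have hdisj : Disjoint (A ∪ S) (U \ S) := by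
      rw [Finset.disjoint_union_left]
      exact ⟨hAU.mono_right Finset.sdiff_subset, Finset.disjoint_sdiff⟩
    have hT' : T ⊆ (A ∪ S) ∪ (U \ S) := by
      rw [Finset.union_assoc, Finset.union_sdiff_of_subset hSU]
      exact hTAU
    have hQ : ((U \ S) \ T).card + ((U \ S) ∩ T).card = (U \ S).card :=
      Finset.card_sdiff_add_card_inter _ _
    by_cases hcase : β (U \ S).card ≤ ((U \ S) \ T).card
    · obtain ⟨R, hR, hRc⟩ := Finset.exists_subset_card_eq hcase
      have hR' : R ⊆ U \ S := hR.trans Finset.sdiff_subset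
      refine ⟨R, hplan.legalMove hR' hRc, Or.inl ⟨hA', ?_, hdisj.mono_right Finset.sdiff_subset,
        ?_, ?_, ?_⟩⟩
      · exact Finset.sdiff_subset.trans (Finset.sdiff_subset.trans hU)
      · rwa [Finset.card_sdiff_of_subset hR', hRc]
      · intro e he
        rcases Finset.mem_union.1 (hT' he) with h | h
        · exact Finset.mem_union_left _ h
        · exact Finset.mem_union_right _ (Finset.mem_sdiff.2
            ⟨h, fun h' => (Finset.mem_sdiff.1 (hR h')).2 he⟩)
      · have hT'' : T ⊆ (A ∪ S) ∪ ((U \ S) \ R) := by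
          intro e he
          rcases Finset.mem_union.1 (hT' he) with h | h
          · exact Finset.mem_union_left _ h
          · exact Finset.mem_union_right _ (Finset.mem_sdiff.2
              ⟨h, fun h' => (Finset.mem_sdiff.1 (hR h')).2 he⟩)
        -- All of `T` is still free or Avoider's, and Avoider has at most n * k edges, so more than
        -- r edges are free.
        have h6 := (Finset.card_le_card hT'').trans (Finset.card_union_le _ _)
        omega
    · push Not at hcase
      -- The move that switches strategies claims everything outside `T` and the rest by the reply
      -- on rows, starting at level 0 with no row cut.
      have hb : RowBalanced own k L D h (A ∪ S) ((U \ S) ∩ T) Z ∅ 0 := by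
        refine ⟨Finset.empty_subset _, by simp, Nat.zero_le _, fun _ _ _ => Nat.zero_le _,
          fun v hv _ => ?_, by simp, by simp, by simp⟩
        have h6 : T.filter (own · = v) ⊆
            ((U \ S) ∩ T).filter (own · = v) ∪ (A ∪ S).filter (v ∈ ·) := by
          intro e he
          obtain ⟨he1, he2⟩ := Finset.mem_filter.1 he
          rcases Finset.mem_union.1 (hT' he1) with h | h
          · exact Finset.mem_union_right _ (Finset.mem_filter.2 ⟨h, he2 ▸ hown e he1⟩)
          · exact Finset.mem_union_left _ (Finset.mem_filter.2
              ⟨Finset.mem_inter.2 ⟨h, he1⟩, he2⟩)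
        have h7 : rowCard own T v ≤ rowCard own ((U \ S) ∩ T) v + edgeDeg (A ∪ S) v :=
          (Finset.card_le_card h6).trans (Finset.card_union_le _ _)
        have h8 := hh v hv
        nlinarith
      have hH' : ∀ v, rowCard own ((U \ S) ∩ T) v ≤ H := fun v =>
        (Finset.card_le_card (Finset.filter_subset_filter _ Finset.inter_subset_right)).trans (hH v)
      obtain ⟨R, hR, hRc, Z', hZ', hw, hbal⟩ := hb.exists_reply hp hdeg
        (β := β (U \ S).card - ((U \ S) \ T).card)
        (fun e he => hown' e (Finset.mem_inter.1 he).2) hH'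
        (by
          refine hM.trans ?_
          rw [rowWeight, Finset.card_eq_sum_ones]
          exact Finset.sum_le_sum fun v _ => Nat.one_le_pow _ _ hp.one_le_lam)
        (by simp) (by omega) (by omega) (by
          rcases h5 with h5 | h5
          · left; omega
          · right; omega)
      have hR' : (U \ S) \ T ∪ R ⊆ U \ S :=
        Finset.union_subset Finset.sdiff_subset (hR.trans Finset.inter_subset_left)
      have hRc' : ((U \ S) \ T ∪ R).card = β (U \ S).card := by
        rw [Finset.card_union_of_disjoint, hRc]
        · omega
        · exact Finset.disjoint_left.2 fun e he he' =>
            (Finset.mem_sdiff.1 he).2 (Finset.mem_inter.1 (hR he')).2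
      have hrest : (U \ S) \ ((U \ S) \ T ∪ R) = ((U \ S) ∩ T) \ R := by
        ext e
        simp only [Finset.mem_sdiff, Finset.mem_union, Finset.mem_inter]
        tauto
      have hrc : ((U \ S) \ ((U \ S) \ T ∪ R)).card = (U \ S).card - β (U \ S).card := by
        rw [Finset.card_sdiff_of_subset hR', hRc']
      refine ⟨_, hplan.legalMove hR' hRc', Or.inr (RowPosition.enforcerWinsFrom hp hplan
        (own := own) (Z := Z') ⟨hA', ?_, ?_, ?_, ?_, ?_, ?_, ?_, hw, ?_⟩)⟩
      · exact Finset.sdiff_subset.trans (Finset.sdiff_subset.trans hU)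
      · exact hdisj.mono_right Finset.sdiff_subset
      · rw [← Finset.card_pos]
        omega
      · rwa [hrc]
      · intro e he
        rw [hrest] at he
        exact hown e (Finset.mem_inter.1 (Finset.mem_sdiff.1 he).1).2
      · rwa [hrest]
      · intro v
        rw [hrest]
        exact (Finset.card_le_card (Finset.filter_subset_filter _ Finset.sdiff_subset)).trans
          (hH' v)
      · refine hbal.imp_right fun ⟨h6, h7⟩ => ⟨by omega, ?_⟩
        rwa [hrest]
  · refine ⟨Finset.empty_subset _, subset_rfl, Finset.disjoint_empty_left _, by rwa [card_edgesK],
      by simpa using hT, ?_⟩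
    have := Finset.card_le_card hT
    omega

/-- The edges between the disjoint sets `Z` and `Y` form rows, one for each vertex of `Z`. -/
theorem exists_bipartite_rows {z y : ℕ} (hzy : z + y ≤ n) :
    ∃ (own : Sym2 (Fin n) → Fin n) (T : Finset (Sym2 (Fin n))) (Z : Finset (Fin n)),
      T ⊆ edgesK n ∧ (∀ e ∈ T, own e ∈ e) ∧ (∀ e ∈ T, own e ∈ Z) ∧ (∀ v, rowCard own T v ≤ y) ∧
      (∀ v ∈ Z, y ≤ rowCard own T v) ∧ Z.card = z ∧ T.card = z * y := by
  classical
  obtain ⟨Z, -, hZ⟩ := Finset.exists_subset_card_eq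
    (show z ≤ (Finset.univ : Finset (Fin n)).card by simp; omega)
  obtain ⟨Y, hYZ, hY⟩ := Finset.exists_subset_card_eq
    (show y ≤ (Finset.univ \ Z).card by
      rw [Finset.card_sdiff_of_subset (Finset.subset_univ _), hZ]; simp; omega)
  have hdis : ∀ x ∈ Y, x ∉ Z := fun x hx => (Finset.mem_sdiff.1 (hYZ hx)).2
  let f : Fin n × Fin n → Sym2 (Fin n) := fun p => s(p.1, p.2)
  have hinj : Set.InjOn f (Z ×ˢ Y : Finset (Fin n × Fin n)) := by
    rintro ⟨a, b⟩ hab ⟨c, d⟩ hcd h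
    simp only [Finset.coe_product, Set.mem_prod, Finset.mem_coe] at hab hcd
    rcases Sym2.eq_iff.1 h with ⟨rfl, rfl⟩ | ⟨rfl, rfl⟩
    · rfl
    · exact absurd hab.1 (hdis _ hcd.2)
  have hex : ∀ e : Sym2 (Fin n), ∃ v, v ∈ e ∧ ((∃ w ∈ e, w ∈ Z) → v ∈ Z) := by
    intro e
    by_cases h : ∃ w ∈ e, w ∈ Z
    · obtain ⟨w, hw, hwZ⟩ := h
      exact ⟨w, hw, fun _ => hwZ⟩
    · induction e with
      | _ a b => exact ⟨a, by simp, fun h' => absurd h' h⟩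
  choose own hown hownZ using hex
  have hownf : ∀ a ∈ Z, ∀ b ∈ Y, own s(a, b) = a := by
    intro a ha b hb
    have h1 := hownZ s(a, b) ⟨a, by simp, ha⟩
    rcases Sym2.mem_iff.1 (hown s(a, b)) with h | h
    · exact h
    · exact absurd (h ▸ h1) (hdis b hb)
  have hrow : ∀ v ∈ Z, rowCard own ((Z ×ˢ Y).image f) v = y := by
    intro v hv
    have : ((Z ×ˢ Y).image f).filter (own · = v) = ({v} ×ˢ Y).image f := by
      ext e
      simp only [Finset.mem_filter, Finset.mem_image, Finset.mem_product, Finset.mem_singleton]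
      constructor
      · rintro ⟨⟨⟨a, b⟩, ⟨ha, hb⟩, rfl⟩, h⟩
        exact ⟨(a, b), ⟨(hownf a ha b hb).symm.trans h, hb⟩, rfl⟩
      · rintro ⟨⟨a, b⟩, ⟨rfl, hb⟩, rfl⟩
        exact ⟨⟨(a, b), ⟨hv, hb⟩, rfl⟩, hownf a hv b hb⟩
    rw [rowCard, this, Finset.card_image_of_injOn, Finset.card_product, hY]
    · simp
    · exact hinj.mono (by
        rintro ⟨a, b⟩ h
        simp only [Finset.coe_product, Set.mem_prod, Finset.mem_coe, Finset.mem_singleton] at h ⊢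
        exact ⟨h.1 ▸ hv, h.2⟩)
  refine ⟨own, (Z ×ˢ Y).image f, Z, ?_, fun e _ => hown e, ?_, ?_, fun v hv => (hrow v hv).ge,
    hZ, ?_⟩
  · intro e he
    obtain ⟨⟨a, b⟩, h, rfl⟩ := Finset.mem_image.1 he
    obtain ⟨ha, hb⟩ := Finset.mem_product.1 h
    exact mk_mem_edgesK.2 fun (h' : a = b) => hdis b hb (h' ▸ ha)
  · intro e he
    obtain ⟨⟨a, b⟩, h, rfl⟩ := Finset.mem_image.1 he
    exact hownZ _ ⟨a, by simp [f], (Finset.mem_product.1 h).1⟩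
  · intro v
    by_cases hv : v ∈ Z
    · exact (hrow v hv).le
    · rw [rowCard, Finset.filter_eq_empty_iff.2]
      · simp
      · intro e he hev
        obtain ⟨⟨a, b⟩, h, rfl⟩ := Finset.mem_image.1 he
        exact hv (hev ▸ hownZ _ ⟨a, by simp [f], (Finset.mem_product.1 h).1⟩)
  · rw [Finset.card_image_of_injOn hinj, Finset.card_product, hZ, hY]

end Static

/-! ### The sizes of Enforcer's moves -/

/-- A full round removes exactly b + 1 edges, so Avoider's last turn comes with exactly the last
remainder. -/
theorem enforcerPlan_strict {n b lo cap : ℕ} (hlo : lo ≤ b) :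
    EnforcerPlan .strict b lo cap b (lastRemainder n b) (fun u => min b u)
      (fun g => ∃ i, g = lastRemainder n b + i * (b + 1)) := by
  obtain ⟨h1, h2, -⟩ := lastRemainder_spec n b
  refine ⟨fun _ => le_rfl, fun _ _ => rfl, ?_⟩
  rintro g a ⟨i, rfl⟩ hr - - - ha
  obtain rfl := ha rfl
  rcases i with _ | i
  · omega
  · have h3 : (i + 1) * (b + 1) = i * (b + 1) + (b + 1) := by ring
    rw [h3]
    refine ⟨by omega, by omega, by omega, ⟨i, by omega⟩, ?_⟩
    rcases i with _ | i
    · left; omega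
    · right
      have h4 : (i + 1) * (b + 1) = i * (b + 1) + (b + 1) := by ring
      omega

/-- As soon as at most 3b edges are free, Enforcer takes all but one. Before that, a move of b edges
leaves more than 2b, and Avoider's at most `cap` ≤ b edges still leave more than b. So the last
remainder is forced to be 1. -/
theorem enforcerPlan_monotone {b lo cap : ℕ} (hb : 1 ≤ b) (hlo : lo ≤ b) (hcap : cap ≤ b) :
    EnforcerPlan .monotone b lo cap (3 * b) 1
      (fun u => if u ≤ b then u else if u ≤ 3 * b then u - 1 else b)
      (fun g => g = 1 ∨ 2 * b < g) := by
  refine ⟨fun u => ?_, fun h => (by cases h), ?_⟩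
  · split_ifs <;> omega
  · rintro g a (rfl | hg) hr ha ha' - -
    · omega
    · rw [if_neg (by omega)]
      split_ifs <;> omega

/-- If Avoider has to claim too many edges in total, then he loses. -/
theorem enforcerWins_strict_of_small_bias {n k b : ℕ} (hn : 2 ≤ n)
    (h : n * (k - 1) * (b + 1) < n.choose 2) :
    EnforcerWins .strict 1 b (edgesK n) (starCopies k n) := by
  classical
  refine enforcerWinsFrom_of_invariant le_rfl
    (fun A U => A ⊆ edgesK n ∧ U ⊆ edgesK n ∧ Disjoint A U ∧ U.Nonempty ∧
      n.choose 2 ≤ A.card * (b + 1) + U.card)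
    (fun A U => enforcerWinsFrom_of_subset le_rfl) (fun A U h => h.2.2.2.1) ?_ ?_
  · rintro A U S ⟨hA, hU, hAU, hne, hc⟩ hS hl
    obtain ⟨R, hR⟩ := exists_legalMove .strict b (U \ S)
    have hSU := hS.1
    have hA' : A ∪ S ⊆ edgesK n := Finset.union_subset hA (hSU.trans hU)
    have hdeg := edgeDeg_lt_of_not_star hA' hl
    have hcard : (A ∪ S).card ≤ n * (k - 1) :=
      card_le_of_edgeDeg_le fun v => Nat.le_sub_one_of_lt (hdeg v)
    have hUc := hne.card_pos
    have hS1 : S.card = 1 := by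
      have := hS.2
      simp only at this
      omega
    have h1 : (U \ S).card = U.card - 1 := by rw [Finset.card_sdiff_of_subset hSU, hS1]
    have h2 : ((U \ S) \ R).card = U.card - 1 - R.card := by
      rw [Finset.card_sdiff_of_subset hR.1, h1]
    have h3 : (A ∪ S).card = A.card + 1 := by
      rw [Finset.card_union_of_disjoint (hAU.mono_right hSU), hS1]
    have h4 : R.card = min b (U \ S).card := hR.2
    have h5 : n.choose 2 ≤ (A ∪ S).card * (b + 1) + ((U \ S) \ R).card := by
      rw [h3, add_mul, h2]
      omega
    refine ⟨R, hR, Or.inl ⟨hA', Finset.sdiff_subset.trans (Finset.sdiff_subset.trans hU), ?_, ?_,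
      h5⟩⟩
    · rw [Finset.disjoint_union_left]
      exact ⟨hAU.mono_right (Finset.sdiff_subset.trans Finset.sdiff_subset),
        Finset.disjoint_sdiff.mono_right Finset.sdiff_subset⟩
    · rw [← Finset.card_pos]
      have := Nat.mul_le_mul_right (b + 1) hcard
      omega
  · refine ⟨Finset.empty_subset _, subset_rfl, Finset.disjoint_empty_left _, ?_, ?_⟩
    · rw [← Finset.card_pos, card_edgesK]
      exact Nat.choose_pos hn
    · rw [card_edgesK]
      omega

/-! ### Growing a set of dead vertices

As long as there are many vertices of degree `0` in Avoider's graph, Enforcer enlarges a set `W` of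
vertices that spans no free edge. Hence all edges of Avoider have an endpoint outside of `W`. -/

section Growth

variable {n : ℕ}

theorem card_edgeDeg_pos_le (A : Finset (Sym2 (Fin n))) :
    (Finset.univ.filter fun v => 0 < edgeDeg A v).card ≤ 2 * A.card := by
  classical
  have : (Finset.univ.filter fun v => 0 < edgeDeg A v) ⊆
      A.biUnion fun e => Finset.univ.filter fun v => v ∈ e := by
    intro v hv
    obtain ⟨e, he, hve⟩ := edgeDeg_pos.1 (Finset.mem_filter.1 hv).2
    exact Finset.mem_biUnion.2 ⟨e, he, by simpa using hve⟩
  rw [mul_comm]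
  exact (Finset.card_le_card this).trans
    (Finset.card_biUnion_le_card_mul _ _ 2 fun e _ => card_filter_mem_sym2_le e)

theorem choose_two_le_card_of_complete {U : Finset (Sym2 (Fin n))} {J : Finset (Fin n)}
    (h : ∀ x ∈ J, ∀ y ∈ J, x ≠ y → s(x, y) ∈ U) :
    J.card.choose 2 ≤ (U.filter fun e => ∀ v ∈ e, v ∈ J).card := by
  classical
  rw [← Sym2.card_image_offDiag]
  refine Finset.card_le_card fun e he => ?_
  obtain ⟨⟨x, y⟩, hxy, rfl⟩ := Finset.mem_image.1 he
  obtain ⟨hx, hy, hne⟩ := Finset.mem_offDiag.1 hxy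
  refine Finset.mem_filter.2 ⟨h x hx y hy hne, fun v hv => ?_⟩
  rcases Sym2.mem_iff.1 hv with rfl | rfl
  · exact hx
  · exact hy

/-- The weight of a vertex of degree `d`: isolated vertices have no weight. -/
def posWeight (lam d : ℕ) : ℕ := if d = 0 then 0 else lam ^ d

theorem posWeight_mono {lam d d' : ℕ} (hlam : 1 ≤ lam) (h : d ≤ d') :
    posWeight lam d ≤ posWeight lam d' := by
  unfold posWeight
  split_ifs with h1 h2
  · exact le_rfl
  · exact Nat.zero_le _
  · omega
  · exact Nat.pow_le_pow_right hlam h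

theorem posWeight_le (lam d : ℕ) : posWeight lam d ≤ lam ^ d := by
  unfold posWeight
  split_ifs
  · exact Nat.zero_le _
  · exact le_rfl

/-- The first edge at a vertex yields lam, and for d ≥ 1 and lam ≥ 2 the step from lam^d to
lam^(d+1) yields at least lam. -/
theorem posWeight_add_le {lam d d' : ℕ} (hlam : 2 ≤ lam) (h : d < d') :
    posWeight lam d + lam ≤ posWeight lam d' := by
  refine le_trans ?_ (posWeight_mono (by omega) (Nat.succ_le_of_lt h))
  rcases Nat.eq_zero_or_pos d with rfl | hd
  · simp [posWeight]
  · have h3 : lam ≤ lam ^ d := Nat.le_self_pow hd.ne' lam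
    rw [posWeight, posWeight, if_neg hd.ne', if_neg (Nat.succ_ne_zero d), Nat.succ_eq_add_one,
      pow_succ]
    nlinarith

/-- A position, with Avoider to move in the strict game, in which no free edge lies inside `W`.
Outside of `W`, only few edges have been claimed by Enforcer, and all of the edges at isolated
vertices outside of `P` are free. -/
structure GrowthPosition (b L D lam : ℕ) (A U : Finset (Sym2 (Fin n))) (W P : Finset (Fin n)) :
    Prop where
  subset_left : A ⊆ edgesK n
  subset_right : U ⊆ edgesK n
  disjoint : Disjoint A U
  card : U.card + A.card * (b + 1) = n.choose 2
  dead : ∀ e ∈ U, ∃ v ∈ e, v ∉ W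
  isolated : ∀ v ∈ P, v ∉ W ∧ edgeDeg A v = 0
  card_le : P.card ≤ L
  fresh : ∀ v, v ∉ W → v ∉ P → edgeDeg A v = 0 → ∀ e ∈ edgesK n, v ∈ e → e ∈ U
  loss : ∀ v, v ∉ W → ((edgesK n).filter fun e => v ∈ e ∧ e ∉ A ∧ e ∉ U).card ≤ D
  weight : lam * A.card ≤ ∑ v ∈ Wᶜ, posWeight lam (edgeDeg A v)

/-- Once `W` has w vertices, the edges from a vertex outside into `W` form a nearly full row. Few
edges avoid `W`, so Avoider has already claimed at least T edges, each worth lam. The strategy on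
rows takes over with M = lam * T. -/
theorem GrowthPosition.enforcerWinsFrom {k b L D h₁ lam T w : ℕ}
    (hp : RowParams k L D n (w - D) h₁ lam (lam * T) b (lastRemainder n b)) (hLb : L * n ≤ b)
    (hT : T * (b + 1) + (n - w) * n ≤ n.choose 2) (hn : 2 ≤ n)
    {A U : Finset (Sym2 (Fin n))} {W P : Finset (Fin n)}
    (hI : GrowthPosition b L D lam A U W P) (hW : w ≤ W.card) (hU : b + 1 < U.card) :
    EnforcerWinsFrom .strict 1 b (starCopies k n) A U := by
  classical
  -- Edges between `W` and its complement are thus owned by the endpoint outside `W`; the choice for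
  -- all others is immaterial.
  have hex : ∀ e : Sym2 (Fin n), ∃ v, v ∈ e ∧ ((∃ w ∈ e, w ∉ W) → v ∉ W) := by
    intro e
    by_cases h : ∃ w ∈ e, w ∉ W
    · obtain ⟨w, hw, hwZ⟩ := h
      exact ⟨w, hw, fun _ => hwZ⟩
    · induction e with
      | _ a b => exact ⟨a, by simp, fun h' => absurd h' h⟩
  choose own hown hownZ using hex
  have hrow : ∀ v, rowCard own U v ≤ edgeDeg U v := by
    intro v
    refine Finset.card_le_card fun e he => ?_
    obtain ⟨h1, h2⟩ := Finset.mem_filter.1 he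
    exact Finset.mem_filter.2 ⟨h1, h2 ▸ hown e⟩
  have hWrow : ∀ v, v ∉ W → w ≤ rowCard own U v + edgeDeg A v + D := by
    intro v hv
    have hinj : Function.Injective fun u : Fin n => s(v, u) := fun x y h => Sym2.congr_right.1 h
    have hsub : W.image (fun u => s(v, u)) ⊆ (U.filter (own · = v) ∪ A.filter (v ∈ ·)) ∪
        (edgesK n).filter fun e => v ∈ e ∧ e ∉ A ∧ e ∉ U := by
      intro e he
      obtain ⟨x, hx, rfl⟩ := Finset.mem_image.1 he
      have hvx : v ≠ x := fun h => hv (h ▸ hx)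
      by_cases hA : s(v, x) ∈ A
      · simp [hA]
      by_cases hU : s(v, x) ∈ U
      · refine Finset.mem_union_left _ (Finset.mem_union_left _ (Finset.mem_filter.2 ⟨hU, ?_⟩))
        have h1 := hownZ s(v, x) ⟨v, by simp, hv⟩
        rcases Sym2.mem_iff.1 (hown s(v, x)) with h | h
        · exact h
        · exact absurd hx (by rwa [h] at h1)
      · refine Finset.mem_union_right _ (Finset.mem_filter.2 ⟨mk_mem_edgesK.2 hvx, by simp, hA, hU⟩)
    have h1 := Finset.card_le_card hsub
    rw [Finset.card_image_of_injective _ hinj] at h1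
    have h2 := Finset.card_union_le (U.filter (own · = v) ∪ A.filter (v ∈ ·))
      ((edgesK n).filter fun e => v ∈ e ∧ e ∉ A ∧ e ∉ U)
    have h3 := Finset.card_union_le (U.filter (own · = v)) (A.filter (v ∈ ·))
    have h4 := hI.loss v hv
    simp only [rowCard, edgeDeg] at *
    omega
  have hcard : T ≤ A.card := by
    have h1 : U ⊆ Wᶜ.biUnion fun v => U.filter (v ∈ ·) := by
      intro e he
      obtain ⟨v, hv, hvW⟩ := hI.dead e he
      exact Finset.mem_biUnion.2 ⟨v, by simpa using hvW, by simp [he, hv]⟩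
    have h2 : U.card ≤ Wᶜ.card * n := (Finset.card_le_card h1).trans
      (Finset.card_biUnion_le_card_mul _ _ n fun v _ => edgeDeg_le U v)
    rw [Finset.card_compl, Fintype.card_fin] at h2
    have h3 : (n - W.card) * n ≤ (n - w) * n := Nat.mul_le_mul_right _ (by omega)
    have h4 := hI.card
    exact Nat.le_of_mul_le_mul_right (show T * (b + 1) ≤ A.card * (b + 1) by omega)
      (Nat.succ_pos b)
  have hM : lam * T ≤ rowWeight lam A Wᶜ :=
    (Nat.mul_le_mul_left _ hcard).trans
      (hI.weight.trans (Finset.sum_le_sum fun v _ => posWeight_le _ _))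
  obtain ⟨i, hi⟩ := exists_choose_two_eq_lastRemainder_add (b := b) hn
  obtain ⟨hr1, hr2, -⟩ := lastRemainder_spec n b
  refine RowPosition.enforcerWinsFrom hp (enforcerPlan_strict hLb) (own := own) (Z := Wᶜ)
    ⟨hI.subset_left, hI.subset_right, hI.disjoint, ?_, ?_, fun e _ => hown e, ?_,
      fun v => (hrow v).trans (edgeDeg_le U v), fun v _ => hM.trans (Nat.le_add_right _ _),
      Or.inr ⟨by omega, P, 0, ?_⟩⟩
  · rw [← Finset.card_pos]
    omega
  · have h1 := hI.card
    have h2 : A.card ≤ i := by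
      by_contra! hlt
      have := Nat.mul_le_mul_right (b + 1) (Nat.succ_le_of_lt hlt)
      rw [Nat.succ_mul] at this
      omega
    refine ⟨i - A.card, ?_⟩
    rw [Nat.sub_mul]
    have := Nat.mul_le_mul_right (b + 1) h2
    omega
  · intro e he
    simpa using hownZ e (hI.dead e he)
  · refine ⟨fun v hv => by simpa using (hI.isolated v hv).1, hI.card_le, Nat.zero_le _,
      fun _ _ _ => Nat.zero_le _, fun v hv _ => ?_, fun v hv => (hI.isolated v hv).2.le,
      fun _ _ => Nat.zero_le _, fun v hv => ?_⟩
    · have h1 := hWrow v (by simpa using hv)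
      nlinarith [Nat.sub_le_iff_le_add.2 h1]
    · have h1 := hWrow v (hI.isolated v hv).1
      rw [(hI.isolated v hv).2] at h1 ⊢
      omega

theorem card_compl_filter_edgeDeg_eq_zero (A : Finset (Sym2 (Fin n))) (W P : Finset (Fin n)) :
    n ≤ (Finset.univ.filter fun v => v ∉ W ∧ v ∉ P ∧ edgeDeg A v = 0).card + W.card + P.card +
      2 * A.card := by
  classical
  have hsub : (Finset.univ : Finset (Fin n)) ⊆
      (((Finset.univ.filter fun v => v ∉ W ∧ v ∉ P ∧ edgeDeg A v = 0) ∪ W) ∪ P) ∪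
        Finset.univ.filter fun v => 0 < edgeDeg A v := by
    intro v _
    simp only [Finset.mem_union, Finset.mem_filter, Finset.mem_univ, true_and]
    by_cases h : edgeDeg A v = 0
    · tauto
    · right; omega
  have h1 := Finset.card_le_card hsub
  rw [Finset.card_univ, Fintype.card_fin] at h1
  have h2 := Finset.card_union_le
    (((Finset.univ.filter fun v => v ∉ W ∧ v ∉ P ∧ edgeDeg A v = 0) ∪ W) ∪ P)
    (Finset.univ.filter fun v => 0 < edgeDeg A v)
  have h3 := Finset.card_union_le
    ((Finset.univ.filter fun v => v ∉ W ∧ v ∉ P ∧ edgeDeg A v = 0) ∪ W) P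
  have h4 := Finset.card_union_le
    (Finset.univ.filter fun v => v ∉ W ∧ v ∉ P ∧ edgeDeg A v = 0) W
  have h5 := card_edgeDeg_pos_le A
  omega

/-- Enforcer's reply to an edge `e`: he can enlarge the dead set. -/
theorem GrowthPosition.exists_reply {b L D lam w f : ℕ} (hlam : 2 ≤ lam) (hLb : L * n ≤ b)
    (hLD : n ≤ L * D) (hL : 1 ≤ L)
    (hw : w + 2 * (n.choose 2 / (b + 1) + 1) + 2 * L + 2 * f ≤ n)
    (hf : 2 * (b + 1) ≤ f.choose 2)
    {A U : Finset (Sym2 (Fin n))} {W P : Finset (Fin n)}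
    (hI : GrowthPosition b L D lam A U W P) (hW : W.card < w) {e : Sym2 (Fin n)} (he : e ∈ U) :
    ∃ R ⊆ U \ {e}, R.card = b ∧ b + 1 < ((U \ {e}) \ R).card ∧
      ∃ W' P', GrowthPosition b L D lam (A ∪ {e}) ((U \ {e}) \ R) W' P' := by
  classical
  set A' := A ∪ {e} with hA'
  set U₁ := U \ {e} with hU₁
  have heA : e ∉ A := fun h => Finset.disjoint_left.1 hI.disjoint h he
  have hAe : Disjoint A {e} := Finset.disjoint_singleton_right.2 heA
  have hA'c : A'.card = A.card + 1 := by
    rw [hA', Finset.card_union_of_disjoint hAe, Finset.card_singleton]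
  have hU₁c : U₁.card + 1 = U.card := by
    rw [hU₁, Finset.card_sdiff_of_subset (by simpa using he), Finset.card_singleton]
    have := Finset.card_pos.2 ⟨e, he⟩
    omega
  have hmono : ∀ v, edgeDeg A v ≤ edgeDeg A' v := edgeDeg_mono Finset.subset_union_left
  have hzero : ∀ v, edgeDeg A' v = 0 → v ∉ e := by
    intro v hv hve
    have : 0 < edgeDeg A' v := edgeDeg_pos.2 ⟨e, by simp [hA'], hve⟩
    omega
  set P₀ := P.filter fun v => edgeDeg A' v = 0 with hP₀
  set Z₀ := Finset.univ.filter fun v => v ∉ W ∧ edgeDeg A' v = 0 with hZ₀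
  set J := Finset.univ.filter fun v => v ∉ W ∧ v ∉ P₀ ∧ edgeDeg A' v = 0 with hJ
  have hP₀Z₀ : P₀ ⊆ Z₀ := by
    intro v hv
    obtain ⟨h1, h2⟩ := Finset.mem_filter.1 hv
    simp [hZ₀, h2, (hI.isolated v h1).1]
  have hP₀c : P₀.card ≤ L := (Finset.card_le_card (Finset.filter_subset _ _)).trans hI.card_le
  have hJfresh : ∀ v ∈ J, ∀ e' ∈ edgesK n, v ∈ e' → e' ∈ U₁ := by
    intro v hv e' he' hve
    simp only [hJ, hP₀, Finset.mem_filter, Finset.mem_univ, true_and] at hv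
    have h1 : edgeDeg A v = 0 := by have := hmono v; omega
    refine Finset.mem_sdiff.2 ⟨hI.fresh v hv.1 (fun h => hv.2.1 ⟨h, hv.2.2⟩) h1 e' he' hve, ?_⟩
    rw [Finset.mem_singleton]
    rintro rfl
    exact hzero v hv.2.2 hve
  have hJc : 2 * f + L ≤ J.card := by
    have h1 := card_compl_filter_edgeDeg_eq_zero A' W P₀
    rw [← hJ] at h1
    have h2 : A.card ≤ n.choose 2 / (b + 1) :=
      (Nat.le_div_iff_mul_le (Nat.succ_pos b)).2
        (show A.card * (b + 1) ≤ n.choose 2 by have := hI.card; omega)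
    omega
  have hcomplete : ∀ J' ⊆ J, J'.card.choose 2 ≤ (U₁.filter fun e => ∀ v ∈ e, v ∈ J').card :=
    fun J' hJ' => choose_two_le_card_of_complete fun x hx y _ hxy =>
      hJfresh x (hJ' hx) _ (mk_mem_edgesK.2 hxy) (by simp)
  -- the vertices that die in this move
  obtain ⟨K, hKmem, hKmax⟩ := Finset.exists_max_image
    (Z₀.powerset.filter fun K => P₀ ⊆ K ∧
      (U₁.filter fun e => ∀ v ∈ e, v ∈ W ∪ K).card ≤ b) Finset.card ⟨P₀, by
        simp only [Finset.mem_filter, Finset.mem_powerset]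
        refine ⟨hP₀Z₀, subset_rfl, le_trans ?_ hLb⟩
        have h1 : (U₁.filter fun e => ∀ v ∈ e, v ∈ W ∪ P₀) ⊆
            P₀.biUnion fun v => U.filter (v ∈ ·) := by
          intro e' he'
          obtain ⟨h1, h2⟩ := Finset.mem_filter.1 he'
          have h3 := (Finset.mem_sdiff.1 h1).1
          obtain ⟨v, hv, hvW⟩ := hI.dead e' h3
          refine Finset.mem_biUnion.2 ⟨v, ?_, Finset.mem_filter.2 ⟨h3, hv⟩⟩
          exact (Finset.mem_union.1 (h2 v hv)).resolve_left hvW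
        exact (Finset.card_le_card h1).trans ((Finset.card_biUnion_le_card_mul _ _ n
          fun v _ => edgeDeg_le U v).trans (Nat.mul_le_mul_right _ hP₀c))⟩
  simp only [Finset.mem_filter, Finset.mem_powerset] at hKmem hKmax
  obtain ⟨hKZ, hP₀K, hKb⟩ := hKmem
  -- All edges between fresh vertices are free, so f of them would span more than b edges.
  have hJK : (J ∩ K).card < f := by
    by_contra! hle
    have h1 := hcomplete (J ∩ K) Finset.inter_subset_left
    have h2 : f.choose 2 ≤ (J ∩ K).card.choose 2 := Nat.choose_le_choose 2 hle
    have h3 : (U₁.filter fun e => ∀ v ∈ e, v ∈ J ∩ K).card ≤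
        (U₁.filter fun e => ∀ v ∈ e, v ∈ W ∪ K).card := by
      refine Finset.card_le_card fun e' he' => ?_
      obtain ⟨h4, h5⟩ := Finset.mem_filter.1 he'
      exact Finset.mem_filter.2 ⟨h4, fun v hv =>
        Finset.mem_union_right _ (Finset.mem_inter.1 (h5 v hv)).2⟩
    omega
  have hJK' : f + L < (J \ K).card := by
    have := Finset.card_sdiff_add_card_inter J K
    omega
  set W' := W ∪ K with hW'
  have hJW' : ∀ v ∈ J \ K, v ∉ W' := by
    intro v hv
    obtain ⟨h1, h2⟩ := Finset.mem_sdiff.1 hv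
    rw [hW', Finset.mem_union, not_or]
    exact ⟨(Finset.mem_filter.1 h1).2.1, h2⟩
  set Q := U₁.filter fun e => ∀ v ∈ e, v ∈ W' with hQ
  -- the surplus
  have hsurplus : b < Q.card + W'.card := by
    obtain ⟨p, hp⟩ := Finset.card_pos.1 (show 0 < (J \ K).card by omega)
    obtain ⟨hpJ, hpK⟩ := Finset.mem_sdiff.1 hp
    simp only [hJ, Finset.mem_filter, Finset.mem_univ, true_and] at hpJ
    -- A fresh vertex p joining `K` adds at most one edge per vertex of `W'`, so it would still fit.
    by_contra! hle
    have := hKmax (insert p K) ⟨Finset.insert_subset (by simp [hZ₀, hpJ]) hKZ,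
      hP₀K.trans (Finset.subset_insert _ _), ?_⟩
    · rw [Finset.card_insert_of_notMem hpK] at this
      omega
    · have h1 : (U₁.filter fun e => ∀ v ∈ e, v ∈ W ∪ insert p K) ⊆
          Q ∪ W'.image fun u => s(p, u) := by
        intro e' he'
        obtain ⟨h1, h2⟩ := Finset.mem_filter.1 he'
        have h3 : ∀ v ∈ e', v = p ∨ v ∈ W' := by
          intro v hv
          have := h2 v hv
          simp only [Finset.mem_union, Finset.mem_insert, hW'] at this ⊢
          tauto
        by_cases hpe : p ∈ e'
        · obtain ⟨u, rfl⟩ := Sym2.mem_iff_exists.1 hpe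
          refine Finset.mem_union_right _ (Finset.mem_image.2 ⟨u, ?_, rfl⟩)
          refine (h3 u (by simp)).resolve_left ?_
          rintro rfl
          exact mk_mem_edgesK.1 (hI.subset_right (Finset.mem_sdiff.1 h1).1) rfl
        · refine Finset.mem_union_left _ (Finset.mem_filter.2 ⟨h1, fun v hv => ?_⟩)
          exact (h3 v hv).resolve_left fun h => hpe (h ▸ hv)
      exact (Finset.card_le_card h1).trans ((Finset.card_union_le _ _).trans
        ((Nat.add_le_add_left Finset.card_image_le _).trans hle))
  -- The missing b - |Q| edges go from L fresh vertices into `W'`, at most D from each. `S` is the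
  -- new `P`.
  obtain ⟨S, hS, hSc⟩ := Finset.exists_subset_card_eq (show L ≤ (J \ K).card by omega)
  obtain ⟨X, hX, hXc⟩ := Finset.exists_subset_card_eq (min_le_right D W'.card)
  let φ : Fin n × Fin n → Sym2 (Fin n) := fun p => s(p.1, p.2)
  have hinj : Set.InjOn φ (S ×ˢ X : Finset (Fin n × Fin n)) := by
    rintro ⟨a, b⟩ hab ⟨c, d⟩ hcd h
    simp only [Finset.coe_product, Set.mem_prod, Finset.mem_coe] at hab hcd
    rcases Sym2.eq_iff.1 h with ⟨rfl, rfl⟩ | ⟨rfl, rfl⟩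
    · rfl
    · exact absurd (hX hcd.2) (hJW' _ (hS hab.1))
  have hpool : ((S ×ˢ X).image φ).card = L * min D W'.card := by
    rw [Finset.card_image_of_injOn hinj, Finset.card_product, hSc, hXc]
  have hW'n : W'.card ≤ n := by simpa using Finset.card_le_univ W'
  have hpool' : b - Q.card ≤ ((S ×ˢ X).image φ).card := by
    rw [hpool]
    rcases min_cases D W'.card with ⟨h, -⟩ | ⟨h, -⟩
    · rw [h]; omega
    · rw [h]
      have := Nat.le_mul_of_pos_left W'.card hL
      omega
  obtain ⟨T, hT, hTc⟩ := Finset.exists_subset_card_eq hpool'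
  have hTmem : ∀ e' ∈ T, ∃ a ∈ S, ∃ x ∈ X, e' = s(a, x) := by
    intro e' he'
    obtain ⟨⟨a, x⟩, h, rfl⟩ := Finset.mem_image.1 (hT he')
    obtain ⟨h1, h2⟩ := Finset.mem_product.1 h
    exact ⟨a, h1, x, h2, rfl⟩
  have hTU : T ⊆ U₁ := by
    intro e' he'
    obtain ⟨a, ha, x, hx, rfl⟩ := hTmem e' he'
    refine hJfresh a (Finset.mem_sdiff.1 (hS ha)).1 _ (mk_mem_edgesK.2 ?_) (by simp)
    rintro rfl
    exact hJW' _ (hS ha) (hX hx)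
  have hQT : Disjoint Q T := by
    refine Finset.disjoint_left.2 fun e' he' he'' => ?_
    obtain ⟨a, ha, x, hx, rfl⟩ := hTmem e' he''
    exact hJW' _ (hS ha) ((Finset.mem_filter.1 he').2 a (by simp))
  have hR : Q ∪ T ⊆ U₁ := Finset.union_subset (Finset.filter_subset _ _) hTU
  have hRc : (Q ∪ T).card = b := by
    rw [Finset.card_union_of_disjoint hQT]
    omega
  have hTv : ∀ v, v ∉ W' → ∀ e' ∈ T, v ∈ e' → v ∈ S ∧ ∃ x ∈ X, e' = s(v, x) := by
    intro v hv e' he' hve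
    obtain ⟨a, ha, x, hx, rfl⟩ := hTmem e' he'
    rcases Sym2.mem_iff.1 hve with rfl | rfl
    · exact ⟨ha, x, hx, rfl⟩
    · exact absurd (hX hx) hv
  have hfresh : ∀ v, v ∉ W' → v ∉ S → edgeDeg A' v = 0 → ∀ e' ∈ edgesK n, v ∈ e' →
      e' ∈ U₁ \ (Q ∪ T) := by
    intro v hv hvS hd e' he' hve
    have hvJ : v ∈ J := by
      simp only [hW', Finset.mem_union, not_or] at hv
      simp only [hJ, Finset.mem_filter, Finset.mem_univ, true_and]
      exact ⟨hv.1, fun h => hv.2 (hP₀K h), hd⟩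
    refine Finset.mem_sdiff.2 ⟨hJfresh v hvJ e' he' hve, ?_⟩
    rw [Finset.mem_union, not_or]
    exact ⟨fun h => hv ((Finset.mem_filter.1 h).2 v hve), fun h => hvS (hTv v hv e' h hve).1⟩
  refine ⟨Q ∪ T, hR, hRc, ?_, W', S, Finset.union_subset hI.subset_left
    (by simpa using hI.subset_right he), ?_, ?_, ?_, ?_, ?_, hSc.le, hfresh, ?_, ?_⟩
  · have h1 : f.choose 2 ≤ ((J \ K) \ S).card.choose 2 := by
      refine Nat.choose_le_choose 2 ?_
      rw [Finset.card_sdiff_of_subset hS]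
      omega
    have h2 := choose_two_le_card_of_complete (U := U₁ \ (Q ∪ T)) (J := (J \ K) \ S)
      fun x hx y _ hxy => by
        obtain ⟨hx1, hx2⟩ := Finset.mem_sdiff.1 hx
        exact hfresh x (hJW' x hx1) hx2
          (Finset.mem_filter.1 (Finset.mem_sdiff.1 hx1).1).2.2.2 _ (mk_mem_edgesK.2 hxy) (by simp)
    have h3 := Finset.card_le_card (Finset.filter_subset
      (fun e => ∀ v ∈ e, v ∈ (J \ K) \ S) (U₁ \ (Q ∪ T)))
    omega
  · exact Finset.sdiff_subset.trans (Finset.sdiff_subset.trans hI.subset_right)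
  · rw [Finset.disjoint_union_left]
    exact ⟨hI.disjoint.mono_right (Finset.sdiff_subset.trans Finset.sdiff_subset),
      Finset.disjoint_sdiff.mono_right Finset.sdiff_subset⟩
  · rw [Finset.card_sdiff_of_subset hR, hRc, hA'c, add_mul]
    have h1 := hI.card
    have h2 := Finset.card_le_card hR
    omega
  · intro e' he'
    obtain ⟨h1, h2⟩ := Finset.mem_sdiff.1 he'
    by_contra! h
    exact h2 (Finset.mem_union_left _ (Finset.mem_filter.2 ⟨h1, h⟩))
  · exact fun v hv => ⟨hJW' v (hS hv), (Finset.mem_filter.1 (Finset.mem_sdiff.1 (hS hv)).1).2.2.2⟩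
  · intro v hv
    -- The bound D does not accumulate: a vertex of `S` was fresh until this move, and the old `P`
    -- has either died or ceased to be isolated.
    by_cases hvS : v ∈ S
    · have hinjv : Function.Injective fun u : Fin n => s(v, u) := fun x y h => Sym2.congr_right.1 h
      have h1 : ((edgesK n).filter fun e' => v ∈ e' ∧ e' ∉ A' ∧ e' ∉ U₁ \ (Q ∪ T)) ⊆
          X.image fun u => s(v, u) := by
        intro e' he'
        simp only [Finset.mem_filter, Finset.mem_sdiff, not_and, not_not] at he'
        obtain ⟨h1, h2, -, h4⟩ := he'
        have h5 := h4 (hJfresh v (Finset.mem_sdiff.1 (hS hvS)).1 e' h1 h2)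
        rcases Finset.mem_union.1 h5 with h | h
        · exact absurd ((Finset.mem_filter.1 h).2 v h2) hv
        · obtain ⟨-, x, hx, rfl⟩ := hTv v hv e' h h2
          exact Finset.mem_image_of_mem _ hx
      refine (Finset.card_le_card h1).trans (Finset.card_image_le.trans ?_)
      omega
    · refine le_trans (Finset.card_le_card fun e' he' => ?_)
        (hI.loss v fun h => hv (Finset.mem_union_left _ h))
      simp only [Finset.mem_filter, hA', hU₁, Finset.mem_sdiff, Finset.mem_union,
        Finset.mem_singleton, not_and, not_not, not_or] at he' ⊢
      obtain ⟨h1, h2, ⟨h3, h4⟩, h5⟩ := he'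
      refine ⟨h1, h2, h3, fun h6 => ?_⟩
      by_cases h : e' ∈ Q
      · exact hv ((Finset.mem_filter.1 h).2 v h2)
      · exact hvS (hTv v hv e' (h5 ⟨h6, h4⟩ h) h2).1
  · obtain ⟨v, hve, hvW⟩ := hI.dead e he
    have h1 : ∑ v ∈ Wᶜ, posWeight lam (edgeDeg A v) + lam ≤
        ∑ v ∈ Wᶜ, posWeight lam (edgeDeg A' v) := by
      have hvW' : v ∈ Wᶜ := by simpa using hvW
      rw [← Finset.sum_erase_add _ _ hvW',
        ← Finset.sum_erase_add Wᶜ (fun v => posWeight lam (edgeDeg A' v)) hvW', add_assoc]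
      exact Nat.add_le_add
        (Finset.sum_le_sum fun x _ => posWeight_mono (by omega) (hmono x))
        (posWeight_add_le hlam (edgeDeg_lt_union hAe (Finset.mem_singleton_self e) hve))
    -- Only isolated vertices die, and these carry no weight.
    have h2 : ∑ v ∈ Wᶜ, posWeight lam (edgeDeg A' v) =
        ∑ v ∈ W'ᶜ, posWeight lam (edgeDeg A' v) := by
      symm
      refine Finset.sum_subset (Finset.compl_subset_compl.2 Finset.subset_union_left)
        fun x hx hx' => ?_
      have hxK : x ∈ K := by
        simp only [Finset.mem_compl, hW', Finset.mem_union, not_not] at hx hx'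
        tauto
      rw [(Finset.mem_filter.1 (hKZ hxK)).2.2]
      rfl
    have h3 := hI.weight
    rw [hA'c, mul_add, mul_one, ← h2]
    omega

/-- There are at most N / (b + 1) rounds, so Avoider touches at most twice as many vertices. `hw`
guarantees enough fresh ones until the dead set has w vertices. -/
theorem enforcerWins_of_growth {k b L D h₁ lam T w f : ℕ}
    (hp : RowParams k L D n (w - D) h₁ lam (lam * T) b (lastRemainder n b)) (hLb : L * n ≤ b)
    (hT : T * (b + 1) + (n - w) * n ≤ n.choose 2) (hn : 2 ≤ n) (hlam : 2 ≤ lam) (hL : 1 ≤ L)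
    (hw0 : 0 < w) (hw : w + 2 * (n.choose 2 / (b + 1) + 1) + 2 * L + 2 * f ≤ n)
    (hf : 2 * (b + 1) ≤ f.choose 2) :
    EnforcerWins .strict 1 b (edgesK n) (starCopies k n) := by
  classical
  refine enforcerWinsFrom_of_invariant le_rfl
    (fun A U => b + 1 < U.card ∧ ∃ W P, GrowthPosition b L D lam A U W P ∧ W.card < w)
    (fun A U => enforcerWinsFrom_of_subset le_rfl)
    (fun A U h => Finset.card_pos.1 (by omega)) ?_ ?_
  · rintro A U S ⟨hU, W, P, hI, hW⟩ hS -
    have hS1 : S.card = 1 := by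
      have := hS.2
      simp only at this
      omega
    obtain ⟨e, rfl⟩ := Finset.card_eq_one.1 hS1
    have he : e ∈ U := hS.1 (Finset.mem_singleton_self e)
    obtain ⟨R, hR, hRc, hU', W', P', hI'⟩ := hI.exists_reply hlam hLb hp.H_le hL hw hf hW he
    have hRU := Finset.card_le_card hR
    refine ⟨R, legalMove_of_card_eq hR (by omega), ?_⟩
    by_cases hW' : W'.card < w
    · exact Or.inl ⟨hU', W', P', hI', hW'⟩
    · exact Or.inr (hI'.enforcerWinsFrom hp hLb hT hn (not_lt.1 hW') hU')
  · refine ⟨?_, ∅, ∅, ⟨Finset.empty_subset _, subset_rfl, Finset.disjoint_empty_left _, ?_, ?_, ?_,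
      by simp, fun _ _ _ _ e he _ => he, ?_, ?_⟩, by simpa using hw0⟩
    · rw [card_edgesK]
      have : f.choose 2 ≤ n.choose 2 := Nat.choose_le_choose 2 (by omega)
      omega
    · simp [card_edgesK]
    · intro e _
      induction e with
      | _ x y => exact ⟨x, by simp⟩
    · simp
    · intro v _
      rw [Finset.filter_eq_empty_iff.2]
      · simp
      · exact fun e he h => h.2.2 he
    · simp

end Growth

/-! ### Enforcer wins the star games -/

theorem two_mul_choose_two (n : ℕ) : 2 * n.choose 2 = n * (n - 1) := by
  rw [Nat.choose_two_right]
  exact Nat.mul_div_cancel' (Nat.even_mul_pred_self n).two_dvd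

/-- With L = 8k, the 2k possible charges of about y / (8k) cost a row at most half of its length y.
-/
theorem rowParams_half {k y M B r : ℕ} (hk : 1 ≤ k) (hy : 16 * k ≤ y)
    (hfinal : ∀ m, (m - 1) * (y / 2) < r → m * (B / (y / 2) + 2) ^ (k - 1) < M) :
    RowParams k (8 * k) (y / (8 * k) + 1) y y (y / 2) (B / (y / 2) + 2) M B r := by
  have h1 : 8 * k * (y / (8 * k)) ≤ y := Nat.mul_div_le y (8 * k)
  have h2 : y < 8 * k * (y / (8 * k) + 1) := Nat.lt_mul_div_succ y (by omega)
  have h3 : y / (8 * k) ≤ y / 8 := Nat.div_le_div_left (by omega) (by norm_num)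
  have h4 : 2 * k * (y / (8 * k) + 1 + 1) * 4 = 8 * k * (y / (8 * k)) + 16 * k := by ring
  refine ⟨h2.le, by omega, by omega, by omega, ?_, Nat.le_add_left 1 (_ + 1), hfinal⟩
  have h5 : B < (y / 2) * (B / (y / 2) + 1) := Nat.lt_mul_div_succ B (by omega)
  rw [mul_comm]
  exact h5.le

/-- As r = 1, at most one row survives, so it suffices that lam^(k-1) is less than the n / 2 initial
rows. Here lam is at most 17b / n, since a move has at most 3b edges and rows keep about n / 4. -/
theorem enforcerWins_monotone {k n b : ℕ} (hk : 1 ≤ k) (hn : 40 * k ≤ n) (hnb : 8 * k * n ≤ b)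
    (hbn : 20 * b ≤ n ^ 2) (h : (17 * b) ^ (k - 1) * 3 < n ^ k) :
    EnforcerWins .monotone 1 b (edgesK n) (starCopies k n) := by
  obtain ⟨own, T, Z, hT, h1, h2, h3, h4, h5, h6⟩ :=
    exists_bipartite_rows (n := n) (z := n / 2) (y := n / 2) (by omega)
  have hnk : n * k ≤ b := by nlinarith
  have hlam : (3 * b / (n / 2 / 2) + 2) * n ≤ 17 * b := by
    have h7 : 3 * b / (n / 2 / 2) * (n / 2 / 2) ≤ 3 * b := Nat.div_mul_le_self _ _
    have h8 : n ≤ 5 * (n / 2 / 2) := by omega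
    have h9 : 2 * n ≤ 2 * b := by nlinarith
    calc (3 * b / (n / 2 / 2) + 2) * n = 3 * b / (n / 2 / 2) * n + 2 * n := by ring
      _ ≤ 3 * b / (n / 2 / 2) * (5 * (n / 2 / 2)) + 2 * b :=
        Nat.add_le_add (Nat.mul_le_mul_left _ h8) h9
      _ = 5 * (3 * b / (n / 2 / 2) * (n / 2 / 2)) + 2 * b := by ring
      _ ≤ 17 * b := by omega
  have hpow : (3 * b / (n / 2 / 2) + 2) ^ (k - 1) < n / 2 := by
    have h7 : (3 * b / (n / 2 / 2) + 2) ^ (k - 1) * n ^ (k - 1) * 3 < n * n ^ (k - 1) := by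
      rw [← mul_pow, ← pow_succ', Nat.sub_add_cancel hk]
      exact (Nat.mul_le_mul_right 3 (Nat.pow_le_pow_left hlam _)).trans_lt h
    have h8 : 0 < n ^ (k - 1) := Nat.pow_pos (by omega)
    have h9 : (3 * b / (n / 2 / 2) + 2) ^ (k - 1) * 3 < n := by
      refine Nat.lt_of_mul_lt_mul_right (a := n ^ (k - 1)) ?_
      linarith
    omega
  refine enforcerWins_of_rows (rowParams_half (y := n / 2) (M := n / 2) (B := 3 * b) (r := 1) hk
    (by omega) ?_) (enforcerPlan_monotone (by nlinarith) (by nlinarith [Nat.div_le_self n 2]) hnk)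
    hT (Or.inr ?_) h1 h2 h3 h4 h5.ge ?_
  · intro m hm
    have h7 : m ≤ 1 := by
      by_contra! hm'
      have : 1 * 1 ≤ (m - 1) * (n / 2 / 2) := Nat.mul_le_mul (by omega) (by omega)
      omega
    calc m * (3 * b / (n / 2 / 2) + 2) ^ (k - 1)
        ≤ 1 * (3 * b / (n / 2 / 2) + 2) ^ (k - 1) := Nat.mul_le_mul_right _ h7
      _ < n / 2 := by rwa [one_mul]
  · have h7 := two_mul_choose_two n
    have h8 : n ≤ 2 * (n - 1) := by omega
    have h9 : n * n ≤ n * (2 * (n - 1)) := Nat.mul_le_mul_left _ h8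
    have h10 : 0 < b := by nlinarith
    nlinarith
  · rw [h6]
    have h7 : n ≤ 3 * (n / 2) := by omega
    nlinarith

/-- A move must have room for L full rows, so the rows are shortened to b / (8kC). Then lam and the
number of final rows are bounded in terms of k and C, while n / 2 rows exist at the start. -/
theorem enforcerWins_strict_of_linear_bias {k n b : ℕ} (C : ℕ) (hC : 1 ≤ C) (hk : 1 ≤ k)
    (hn : 2 * (8 * k * C * (8 * k * C * 4 + 2) ^ k * (8 * k ^ 2 + 4)) + 4 ≤ n)
    (hnb : n ≤ 4 * k * b) (hbn : b ≤ C * n) :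
    EnforcerWins .strict 1 b (edgesK n) (starCopies k n) := by
  set E := 8 * k * C with hE
  have hE1 : 8 ≤ E := by nlinarith
  have hEk : 8 * k ≤ E := by nlinarith
  have hP : 1 ≤ (E * 4 + 2) ^ (k - 1) := Nat.one_le_pow _ _ (by omega)
  have hPk : (E * 4 + 2) ^ k = (E * 4 + 2) ^ (k - 1) * (E * 4 + 2) := by
    rw [← pow_succ, Nat.sub_add_cancel hk]
  have hn1 : 2 * (4 * E * (E * 4 + 2) ^ (k - 1)) + 4 ≤ n := by
    refine le_trans ?_ hn
    rw [hPk]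
    have : 4 * (E * (E * 4 + 2) ^ (k - 1)) ≤
        (E * (E * 4 + 2) ^ (k - 1)) * ((E * 4 + 2) * (8 * k ^ 2 + 4)) := by
      rw [mul_comm]
      refine Nat.mul_le_mul_left _ ?_
      nlinarith
    nlinarith
  have hn2 : 2 * (E * (8 * k ^ 2 + 4)) + 4 ≤ n := by
    refine le_trans ?_ hn
    have : E * 1 ≤ E * (E * 4 + 2) ^ k := Nat.mul_le_mul_left _ (Nat.one_le_pow _ _ (by omega))
    nlinarith
  have hn3 : 64 * k ^ 2 * E ≤ n := by
    refine le_trans ?_ hn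
    rw [hPk]
    have h1 : 8 * k ^ 2 * (E * 8) ≤ (8 * k ^ 2 + 4) * (E * (E * 4 + 2) * (E * 4 + 2) ^ (k - 1)) := by
      refine Nat.mul_le_mul (by omega) ?_
      have : E * (E * 4 + 2) * 1 ≤ E * (E * 4 + 2) * (E * 4 + 2) ^ (k - 1) :=
        Nat.mul_le_mul_left _ hP
      nlinarith
    nlinarith
  have hb : 16 * k * E ≤ b := by
    by_contra! hlt
    have : 4 * k * b < 4 * k * (16 * k * E) := Nat.mul_lt_mul_of_pos_left hlt (by omega)
    nlinarith
  set y := b / E with hy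
  have hy16 : 16 * k ≤ y := (Nat.le_div_iff_mul_le (by omega)).2 hb
  have hbE : b < E * (y + 1) := Nat.lt_mul_div_succ b (by omega)
  have hyb : E * y ≤ b := Nat.mul_div_le b E
  have hbE' : b + 1 ≤ 4 * E * (y / 2) := by
    have h1 : y + 1 ≤ 4 * (y / 2) := by omega
    nlinarith
  have hyn : 8 * k * y ≤ n := by
    have : C * (8 * k * y) ≤ C * n := by nlinarith
    exact Nat.le_of_mul_le_mul_left this hC
  have hyn2 : 2 * y ≤ n := by nlinarith
  obtain ⟨own, T, Z, hT, h1, h2, h3, h4, h5, h6⟩ :=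
    exists_bipartite_rows (n := n) (z := n / 2) (y := y) (by omega)
  obtain ⟨hr1, hr2, -⟩ := lastRemainder_spec n b
  have hlam : b / (y / 2) ≤ E * 4 := by
    refine Nat.div_le_of_le_mul ?_
    nlinarith
  obtain ⟨i, hi⟩ := exists_choose_two_eq_lastRemainder_add (n := n) (b := b) (by omega)
  refine enforcerWins_of_rows (rowParams_half (y := y) (M := n / 2) (B := b)
    (r := lastRemainder n b) hk hy16 ?_) (enforcerPlan_strict (by nlinarith)) hT ⟨i, hi⟩ h1 h2 h3
    h4 h5.ge ?_
  · intro m hm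
    have h7 : m - 1 < 4 * E := by
      refine Nat.lt_of_mul_lt_mul_right (a := y / 2) ?_
      omega
    calc m * (b / (y / 2) + 2) ^ (k - 1) ≤ (4 * E) * (E * 4 + 2) ^ (k - 1) :=
          Nat.mul_le_mul (by omega) (Nat.pow_le_pow_left (by omega) _)
      _ < n / 2 := by omega
  · rw [h6]
    have h11 : b + 1 ≤ 2 * E * y := by
      have h7 : 2 * (y / 2) ≤ y := Nat.mul_div_le y 2
      calc b + 1 ≤ 4 * E * (y / 2) := hbE'
        _ = 2 * E * (2 * (y / 2)) := by ring
        _ ≤ 2 * E * y := Nat.mul_le_mul_left _ h7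
    have h7 : n * k ≤ 8 * k ^ 2 * E * y := by
      have h8 : b ≤ 2 * E * y := by omega
      calc n * k ≤ 4 * k * b * k := Nat.mul_le_mul_right _ hnb
        _ = 4 * k ^ 2 * b := by ring
        _ ≤ 4 * k ^ 2 * (2 * E * y) := Nat.mul_le_mul_left _ h8
        _ = _ := by ring
    have h9 : E * (8 * k ^ 2 + 4) + 2 ≤ n / 2 := by omega
    have h10 : (E * (8 * k ^ 2 + 4) + 2) * y ≤ n / 2 * y := Nat.mul_le_mul_right _ h9
    have h12 : (E * (8 * k ^ 2 + 4) + 2) * y = 8 * k ^ 2 * E * y + 2 * (2 * E * y) + 2 * y := by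
      ring
    omega

-- With rows of length at least 0.98n, lam is about b / n and T about n^2 / (2b). The final
-- requirement (r / n + 1) * lam^(k-2) < T then follows from `hr` and `hρ`, with a factor 2^(k-2) ≥
-- 2 to spare for rounding.
set_option maxHeartbeats 800000 in
theorem enforcerWins_strict_of_superlinear_bias {k n b : ℕ} (hk : 3 ≤ k)
    (hn : 10 ^ 12 * k ^ 2 ≤ n) (hnb : 800 * k * n ≤ b) (hbn : 10 ^ 6 * b ≤ n ^ 2)
    (hρ : (1.5625 : ℝ) * (2 * (b : ℝ)) ^ (k - 1) ≤ (n : ℝ) ^ k)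
    (hr : (lastRemainder n b : ℝ) * (2 * (b : ℝ)) ^ (k - 1) < (n : ℝ) ^ (k + 1)) :
    EnforcerWins .strict 1 b (edgesK n) (starCopies k n) := by
  have hnk : 10 ^ 12 * k ≤ n :=
    (Nat.mul_le_mul_left _ (Nat.le_self_pow two_ne_zero k)).trans hn
  have hn0 : 10 ^ 12 ≤ n := by omega
  set D := n / (400 * k) + 1 with hD
  have hD1 : 400 * k * (n / (400 * k)) ≤ n := Nat.mul_div_le n (400 * k)
  have hD2 : n < 400 * k * D := Nat.lt_mul_div_succ n (by omega)
  have hD3 : n / (400 * k) ≤ n / 400 := Nat.div_le_div_left (by omega) (by norm_num)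
  have hD4 : 2 * k * (D + 1) * 200 = 400 * k * (n / (400 * k)) + 800 * k := by rw [hD]; ring
  set w := n - n / 100 with hw
  set h₁ := n - 2 * (n / 100) with hh₁
  set N := n.choose 2 with hN
  have hN2 : 2 * N = n * (n - 1) := two_mul_choose_two n
  have hNb : N / (b + 1) ≤ n / 1000 := by
    refine Nat.div_le_of_le_mul ?_
    have h1 : n * (n - 1) ≤ n * n := Nat.mul_le_mul_left _ (by omega)
    have h2 : n ≤ 1001 * (n / 1000) := by omega
    nlinarith
  set T := (N - n / 100 * n) / (b + 1) with hTdef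
  have hNn : n / 100 * n ≤ N := by
    have h1 : n / 100 * 100 ≤ n := Nat.div_mul_le_self _ _
    have h2 : n ≤ 2 * (n - 1) := by omega
    nlinarith
  have hT1 : T * (b + 1) ≤ N - n / 100 * n := Nat.div_mul_le_self _ _
  have hT2 : N - n / 100 * n < (b + 1) * (T + 1) := Nat.lt_mul_div_succ _ (Nat.succ_pos b)
  set lam := b / h₁ + 2 with hlam
  have hlam2 : 2 ≤ lam := Nat.le_add_left 2 _
  have hpos : (0 : ℝ) < n := by
    have : 0 < n := by omega
    exact_mod_cast this
  have hbpos : (0 : ℝ) < b := by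
    have : 0 < b := by nlinarith
    exact_mod_cast this
  have hh₁R : (0.98 : ℝ) * n ≤ h₁ := by
    have : 98 * n ≤ 100 * h₁ := by omega
    have : (98 : ℝ) * n ≤ 100 * h₁ := by exact_mod_cast this
    linarith
  have hlamR : (lam : ℝ) * n ≤ 1.03 * b := by
    have h1 : b / h₁ * h₁ ≤ b := Nat.div_mul_le_self _ _
    have h2 : ((b / h₁ : ℕ) : ℝ) * h₁ ≤ b := by exact_mod_cast h1
    have h3 : ((b / h₁ : ℕ) : ℝ) * (0.98 * n) ≤ b :=
      (mul_le_mul_of_nonneg_left hh₁R (Nat.cast_nonneg _)).trans h2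
    have h4 : 2400 * n ≤ b := by nlinarith
    have h5 : (2400 : ℝ) * n ≤ b := by exact_mod_cast h4
    rw [hlam]
    push_cast
    linarith
  have hTR : (0.96 : ℝ) * n ^ 2 ≤ T * (2 * b) := by
    have h1 : ((N : ℕ) : ℝ) * 2 = n * (n - 1) := by
      have : ((2 * N : ℕ) : ℝ) = ((n * (n - 1) : ℕ) : ℝ) := by rw [hN2]
      push_cast [Nat.cast_sub (show 1 ≤ n by omega)] at this
      linarith
    have h2 : N < (b + 1) * (T + 1) + n / 100 * n := by omega
    have h3 : (N : ℝ) < (b + 1) * (T + 1) + ((n / 100 : ℕ) : ℝ) * n := by exact_mod_cast h2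
    have h4 : ((n / 100 : ℕ) : ℝ) ≤ n / 100 := by exact_mod_cast Nat.cast_div_le
    have h5 : ((n / 100 : ℕ) : ℝ) * n ≤ n / 100 * n := mul_le_mul_of_nonneg_right h4 hpos.le
    have h6 : T ≤ n := by
      have h7 : T ≤ N / (b + 1) := Nat.div_le_div_right (Nat.sub_le _ _)
      omega
    have h7 : (T : ℝ) ≤ n := by exact_mod_cast h6
    have h8 : (10 ^ 6 : ℝ) * b ≤ n ^ 2 := by exact_mod_cast hbn
    have h9 : (10 ^ 6 : ℝ) ≤ n := by
      have : 10 ^ 6 ≤ n := by omega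
      exact_mod_cast this
    nlinarith
  have hLb : 400 * k * n ≤ b := by nlinarith
  refine enforcerWins_of_growth (k := k) (L := 400 * k) (D := D) (h₁ := h₁) (lam := lam) (T := T)
    (w := w) (f := n / 400) ⟨hD2.le, by omega, by omega, by omega, ?_,
    one_le_two.trans hlam2, ?_⟩ hLb ?_ (by omega) hlam2 (by omega) (by omega) ?_ ?_
  · have h5 : b < h₁ * (b / h₁ + 1) := Nat.lt_mul_div_succ b (by omega)
    rw [mul_comm]
    exact h5.le
  · intro m hm
    have hlam0 : 0 < lam := two_pos.trans_le hlam2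
    suffices hmT : m * lam ^ (k - 2) < T by
      rw [show k - 1 = (k - 2) + 1 by omega, pow_succ]
      calc m * (lam ^ (k - 2) * lam) = lam * (m * lam ^ (k - 2)) := by ring
        _ < lam * T := Nat.mul_lt_mul_of_pos_left hmT hlam0
    have hTpos : 0 < T := by
      by_contra! h0
      have : T = 0 := Nat.le_zero.1 h0
      rw [this] at hTR
      norm_num at hTR
      nlinarith
    rcases Nat.eq_zero_or_pos m with rfl | hm0
    · simpa using hTpos
    obtain ⟨m, rfl⟩ := Nat.exists_eq_add_of_le' hm0
    set X := (2 * (b : ℝ)) ^ (k - 1) with hX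
    have hXpos : 0 < X := by positivity
    -- 1 / 0.98 from `hr` for the m rows, plus 1 / 1.5625 = 0.64 from `hρ` for the additional one.
    have hmX : ((m + 1 : ℕ) : ℝ) * X ≤ 1.661 * n ^ k := by
      have h1 : (m : ℝ) * h₁ ≤ lastRemainder n b := by
        simp only [Nat.add_sub_cancel] at hm
        exact_mod_cast hm.le
      have h2 : (m : ℝ) * (0.98 * n) ≤ lastRemainder n b :=
        (mul_le_mul_of_nonneg_left hh₁R (Nat.cast_nonneg _)).trans h1
      have h3 : (m : ℝ) * (0.98 * n) * X ≤ n ^ (k + 1) :=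
        (mul_le_mul_of_nonneg_right h2 hXpos.le).trans hr.le
      have h4 : ((m : ℝ) * 0.98 * X) * n ≤ n ^ k * n := by
        rw [← pow_succ]
        linarith
      have h5 := le_of_mul_le_mul_right h4 hpos
      push_cast
      linarith
    -- This is where k ≥ 3 gives the spare factor of about 2.
    have hY : ((1.03 : ℝ) * b) ^ (k - 2) ≤ 0.515 * (2 * b) ^ (k - 2) := by
      have h1 : (1.03 : ℝ) * b = 0.515 * (2 * b) := by ring
      rw [h1, mul_pow]
      refine mul_le_mul_of_nonneg_right ?_ (by positivity)
      calc (0.515 : ℝ) ^ (k - 2) ≤ 0.515 ^ 1 :=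
            pow_le_pow_of_le_one (by norm_num) (by norm_num) (by omega)
        _ = 0.515 := pow_one _
    have hkey : ((m + 1 : ℕ) : ℝ) * lam ^ (k - 2) * (X * n ^ (k - 2)) < T * (X * n ^ (k - 2)) := by
      have h1 : ((lam : ℝ) * n) ^ (k - 2) ≤ 0.515 * (2 * b) ^ (k - 2) :=
        (pow_le_pow_left₀ (by positivity) hlamR _).trans hY
      have h2 : X = 2 * b * (2 * b) ^ (k - 2) := by
        rw [hX, ← pow_succ', show k - 2 + 1 = k - 1 by omega]
      have h3 : (n : ℝ) ^ k = n ^ 2 * n ^ (k - 2) := by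
        rw [← pow_add, show 2 + (k - 2) = k by omega]
      have h4 : (0 : ℝ) < n ^ (k - 2) := by positivity
      have h5 : (0 : ℝ) < (2 * b) ^ (k - 2) := by positivity
      calc ((m + 1 : ℕ) : ℝ) * lam ^ (k - 2) * (X * n ^ (k - 2))
          = (((m + 1 : ℕ) : ℝ) * X) * (lam * n) ^ (k - 2) := by rw [mul_pow]; ring
        _ ≤ (1.661 * n ^ k) * (0.515 * (2 * b) ^ (k - 2)) :=
            mul_le_mul hmX h1 (by positivity) (by positivity)
        _ < 0.96 * n ^ k * (2 * b) ^ (k - 2) := by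
            have : (0 : ℝ) < n ^ k * (2 * b) ^ (k - 2) := by positivity
            linarith
        _ = (0.96 * n ^ 2) * (n ^ (k - 2) * (2 * b) ^ (k - 2)) := by rw [h3]; ring
        _ ≤ (T * (2 * b)) * (n ^ (k - 2) * (2 * b) ^ (k - 2)) :=
            mul_le_mul_of_nonneg_right hTR (by positivity)
        _ = T * (X * n ^ (k - 2)) := by rw [h2]; ring
    have hfin := lt_of_mul_lt_mul_right hkey (by positivity)
    exact_mod_cast hfin
  · have : n - w = n / 100 := by omega
    rw [this]
    omega
  · rw [← hN]
    omega
  · obtain ⟨x, hx⟩ : ∃ x, n / 400 = x + 1 := ⟨n / 400 - 1, by omega⟩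
    have h1 : n ^ 2 ≤ (500 * x) ^ 2 := Nat.pow_le_pow_left (by omega) 2
    have h2 : (500 * x) ^ 2 = 250000 * (x * x) := by ring
    have h3 := two_mul_choose_two (n / 400)
    have h4 : (x + 1) * x = x * x + x := by ring
    rw [hx, Nat.add_sub_cancel] at h3
    rw [hx]
    omega

theorem mul_lt_of_four_mul_lt {k n b : ℕ} (hk : 1 ≤ k) (hb : 1 ≤ b) (h : 4 * k * b < n) :
    2 * ((k - 1) * (b + 1)) < n - 1 := by
  obtain ⟨k, rfl⟩ := Nat.exists_eq_add_of_le' hk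
  · have h3 : k * (b + 1) ≤ k * (2 * b) := Nat.mul_le_mul_left _ (by omega)
    have h4 : 4 * (k + 1) * b = 2 * (k * (2 * b)) + 4 * b := by ring
    simp only [Nat.add_sub_cancel]
    omega

theorem enforcerWins_strict {k n b : ℕ} (hk : 3 ≤ k)
    (hn : 2 * (8 * k * (800 * k) * (8 * k * (800 * k) * 4 + 2) ^ k * (8 * k ^ 2 + 4)) + 4 ≤ n)
    (hn' : 10 ^ 12 * k ^ 2 ≤ n) (hb : 1 ≤ b) (hbn : b ^ 2 ≤ n ^ 3)
    (hρ : (1.5625 : ℝ) * (2 * (b : ℝ)) ^ (k - 1) ≤ (n : ℝ) ^ k)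
    (hr : (lastRemainder n b : ℝ) * (2 * (b : ℝ)) ^ (k - 1) < (n : ℝ) ^ (k + 1)) :
    EnforcerWins .strict 1 b (edgesK n) (starCopies k n) := by
  have hn0 : 10 ^ 12 ≤ n := by nlinarith
  rcases le_or_gt n (4 * k * b) with h1 | h1
  · rcases le_or_gt b (800 * k * n) with h2 | h2
    · exact enforcerWins_strict_of_linear_bias (800 * k) (by omega) (by omega) hn h1 h2
    · refine enforcerWins_strict_of_superlinear_bias hk hn' h2.le ?_ hρ hr
      refine (Nat.pow_le_pow_iff_left (n := 2) (by norm_num)).1 ?_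
      calc (10 ^ 6 * b) ^ 2 = 10 ^ 12 * b ^ 2 := by ring
        _ ≤ n * n ^ 3 := Nat.mul_le_mul hn0 hbn
        _ = (n ^ 2) ^ 2 := by ring
  · refine enforcerWins_strict_of_small_bias (by omega) ?_
    have h3 := mul_lt_of_four_mul_lt (by omega) hb h1
    have h4 := two_mul_choose_two n
    have h5 : n * (2 * ((k - 1) * (b + 1))) < n * (n - 1) :=
      Nat.mul_lt_mul_of_pos_left h3 (by omega)
    have h6 : n * (2 * ((k - 1) * (b + 1))) = 2 * (n * (k - 1) * (b + 1)) := by ring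
    omega

/-! ### Existence of the threshold biases -/

section Thresholds

variable {α : Type*} [DecidableEq α] {X : Finset α} {F : Set (Finset α)}

theorem isGreatest_monotoneThreshold {B : ℕ} (h : ∀ b, B ≤ b → AvoiderWins .monotone 1 b X F) :
    IsGreatest (monotoneThresholdSet X F) (sSup (monotoneThresholdSet X F)) := by
  classical
  suffices hex : ∃ m, IsGreatest (monotoneThresholdSet X F) m by
    obtain ⟨m, hm⟩ := hex
    rwa [hm.csSup_eq]
  let P : ℕ → Prop := fun b => b = 0 ∨ EnforcerWins .monotone 1 b X F
  have hP : ∀ b, P b → b ≤ B := by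
    rintro b (rfl | hb)
    · exact Nat.zero_le _
    · by_contra! hlt
      exact (h b hlt.le).not_enforcerWinsFrom hb
  have hmem : Nat.findGreatest P B ∈ monotoneThresholdSet X F := by
    intro b hb
    constructor
    · intro hE
      exact Nat.le_findGreatest (hP b (Or.inr hE)) (Or.inr hE)
    · intro hle
      rcases Nat.findGreatest_spec (P := P) (Nat.zero_le B) (Or.inl rfl) with h0 | hE
      · omega
      · exact EnforcerWinsFrom.monotone_anti hle hE
  refine ⟨_, hmem, fun m hm => ?_⟩
  rcases Nat.eq_zero_or_pos m with rfl | hm0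
  · exact Nat.zero_le _
  · exact (hmem m hm0).1 ((hm m hm0).2 le_rfl)

theorem le_of_mem_lowerThresholdSet {b m : ℕ} (hb : 1 ≤ b) (h : AvoiderWins .strict 1 b X F)
    (hm : m ∈ lowerThresholdSet X F) : m ≤ b := by
  by_contra! hlt
  exact h.not_enforcerWinsFrom (hm b hb hlt.le)

theorem isGreatest_lowerThreshold {B : ℕ} (h : ∀ b, B ≤ b → AvoiderWins .strict 1 b X F) :
    IsGreatest (lowerThresholdSet X F) (sSup (lowerThresholdSet X F)) := by
  have hbdd : BddAbove (lowerThresholdSet X F) := ⟨B + 1, fun m hm =>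
    le_of_mem_lowerThresholdSet (by omega) (h (B + 1) (by omega)) hm⟩
  exact ⟨Nat.sSup_mem ⟨0, fun b hb hb' => by omega⟩ hbdd, fun m hm => le_csSup hbdd hm⟩

theorem isLeast_upperThreshold {B : ℕ} (h : ∀ b, B ≤ b → AvoiderWins .strict 1 b X F) :
    IsLeast (upperThresholdSet X F) (sInf (upperThresholdSet X F)) :=
  ⟨Nat.sInf_mem ⟨B, fun b hb => h b hb.le⟩, fun _ hm => Nat.sInf_le hm⟩

end Thresholds

/-! ### Avoider wins if his opponent's bias is large -/

theorem two_mul_choose_two_le (n : ℕ) : 2 * n.choose 2 ≤ n ^ 2 := by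
  rw [two_mul_choose_two, pow_two]
  exact Nat.mul_le_mul_left _ (Nat.sub_le _ _)

/-- For such b the closed bound on `degBound n (b + 1) (k - 2)` is below 1, so its integer value is
0. -/
theorem avoiderWins_of_pow_lt {k n b : ℕ} (rule : AERule) (hk : 2 ≤ k)
    (h : 2 ^ (k - 1) * n ^ k < (b + 1) ^ (k - 1)) :
    AvoiderWins rule 1 b (edgesK n) (starCopies k n) := by
  refine avoiderWins_of_degBound_eq_zero rule hk ?_
  have h1 := degBound_mul_pow_le n (b + 1) (k - 2)
  rw [show k - 2 + 1 = k - 1 by omega] at h1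
  have h2 : (2 * n) ^ (k - 2) * n.choose 2 ≤ 2 ^ (k - 1) * n ^ k := by
    calc (2 * n) ^ (k - 2) * n.choose 2 ≤ (2 * n) ^ (k - 2) * (2 * n ^ 2) :=
          Nat.mul_le_mul_left _ (by have := two_mul_choose_two_le n; omega)
      _ = (2 ^ (k - 2) * 2) * (n ^ (k - 2) * n ^ 2) := by rw [mul_pow]; ring
      _ = 2 ^ (k - 1) * n ^ k := by
        rw [← pow_succ, ← pow_add, show k - 2 + 1 = k - 1 by omega, show k - 2 + 2 = k by omega]
  by_contra hne
  have h3 : (b + 1) ^ (k - 1) ≤ degBound n (b + 1) (k - 2) * (b + 1) ^ (k - 1) :=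
    Nat.le_mul_of_pos_left _ (Nat.pos_of_ne_zero hne)
  omega

theorem avoiderWins_strict_of_pow_lt {k n b : ℕ} (hk : 2 ≤ k) (hn : 2 ≤ n)
    (hr : b + 1 ≤ 2 * lastRemainder n b) (h : 2 ^ k * n ^ (k + 1) < (b + 1) ^ k) :
    AvoiderWins .strict 1 b (edgesK n) (starCopies k n) := by
  refine avoiderWins_strict_of_degBound_lt hk hn ?_
  have h1 := degBound_mul_pow_le n (b + 1) (k - 2)
  rw [show k - 2 + 1 = k - 1 by omega] at h1
  have hpow : (b + 1) ^ k = (b + 1) * (b + 1) ^ (k - 1) := by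
    rw [← pow_succ', Nat.sub_add_cancel (by omega)]
  have h2 : 2 * (2 * n * ((2 * n) ^ (k - 2) * n.choose 2)) ≤ 2 ^ k * n ^ (k + 1) := by
    calc 2 * (2 * n * ((2 * n) ^ (k - 2) * n.choose 2))
        = (2 * n) ^ (k - 2) * (2 * n * (2 * n.choose 2)) := by ring
      _ ≤ (2 * n) ^ (k - 2) * (2 * n * (2 * n ^ 2)) := by
        gcongr
        have := two_mul_choose_two_le n
        omega
      _ = (2 ^ (k - 2) * 2 ^ 2) * (n ^ (k - 2) * n ^ 3) := by rw [mul_pow]; ring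
      _ = 2 ^ k * n ^ (k + 1) := by
        rw [← pow_add, ← pow_add, show k - 2 + 2 = k by omega, show k - 2 + 3 = k + 1 by omega]
  have h3 : 2 * (2 * n * degBound n (b + 1) (k - 2) * (b + 1) ^ (k - 1)) <
      2 * (lastRemainder n b * (b + 1) ^ (k - 1)) := by
    calc 2 * (2 * n * degBound n (b + 1) (k - 2) * (b + 1) ^ (k - 1))
        = 2 * (2 * n * (degBound n (b + 1) (k - 2) * (b + 1) ^ (k - 1))) := by ring
      _ ≤ 2 * (2 * n * ((2 * n) ^ (k - 2) * n.choose 2)) := by gcongr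
      _ ≤ 2 ^ k * n ^ (k + 1) := h2
      _ < (b + 1) * (b + 1) ^ (k - 1) := hpow ▸ h
      _ ≤ 2 * lastRemainder n b * (b + 1) ^ (k - 1) := Nat.mul_le_mul_right _ hr
      _ = 2 * (lastRemainder n b * (b + 1) ^ (k - 1)) := by ring
  exact Nat.lt_of_mul_lt_mul_right (Nat.lt_of_mul_lt_mul_left h3)

/-! ### Biases with a small or large last remainder -/

theorem lastRemainder_eq {n b t r : ℕ} (h : n.choose 2 = t * (b + 1) + r) (h1 : 1 ≤ r)
    (h2 : r ≤ b + 1) : lastRemainder n b = r := by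
  obtain ⟨r, rfl⟩ := Nat.exists_eq_add_of_le' h1
  have h3 : n.choose 2 + b = r + (t + 1) * (b + 1) := by rw [h]; ring
  rw [lastRemainder, h3, Nat.add_mul_mod_self_right, Nat.mod_eq_of_lt (by omega)]

/-- Divide N - 1 by p + 1, where p = N / Q, and let b + 1 be the quotient. Then N exceeds (p + 1)(b
+ 1) by between 1 and p + 1 < n, and this excess is the last remainder. -/
theorem exists_lastRemainder_lt {n Q : ℕ} (hn : 4 ≤ n) (hQ : 8 * n ≤ Q) (hQN : Q ≤ n.choose 2) :
    ∃ b, Q ≤ 4 * b + 8 ∧ b + 1 ≤ Q ∧ 1 ≤ b ∧ lastRemainder n b < n := by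
  have hN := two_mul_choose_two_le n
  set N := n.choose 2
  have ht1 : N / Q * Q ≤ N := Nat.div_mul_le_self N Q
  have ht2 : N < Q * (N / Q + 1) := Nat.lt_mul_div_succ N (by omega)
  have hp : 1 ≤ N / Q := (Nat.one_le_div_iff (by omega)).2 hQN
  set p := N / Q
  have hpn : p + 1 < n := by
    have h1 : p * (8 * n) ≤ p * Q := Nat.mul_le_mul_left _ hQ
    have h2 : 16 * p * n ≤ n * n := by nlinarith
    have h3 : 16 * p ≤ n := Nat.le_of_mul_le_mul_right h2 (by omega)
    omega
  have hq1 : (N - 1) / (p + 1) * (p + 1) ≤ N - 1 := Nat.div_mul_le_self _ _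
  have hq2 : N - 1 < (p + 1) * ((N - 1) / (p + 1) + 1) := Nat.lt_mul_div_succ _ (Nat.succ_pos p)
  set q := (N - 1) / (p + 1)
  have hqQ : q ≤ Q := by
    by_contra! hlt
    have := Nat.mul_le_mul_right (p + 1) hlt.le
    have := Nat.sub_le N 1
    linarith
  have hQq : Q ≤ 4 * q + 4 := by
    have h1 : p + 1 ≤ 2 * p := by omega
    have h2 : (p + 1) * (q + 1) ≤ 2 * p * (q + 1) := Nat.mul_le_mul_right _ h1
    have h5 : N ≤ (p + 1) * (q + 1) := by omega
    have h3 : p * Q ≤ p * (2 * (q + 1)) := by linarith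
    have h4 := Nat.le_of_mul_le_mul_left h3 hp
    omega
  refine ⟨q - 1, by omega, by omega, by omega, ?_⟩
  have hr : N = (p + 1) * q + (N - (p + 1) * q) := by
    have : (p + 1) * q ≤ N := by nlinarith [Nat.sub_le N 1]
    omega
  have hr2 : N - (p + 1) * q ≤ p + 1 := by
    rw [mul_add, mul_one] at hq2
    omega
  rw [lastRemainder_eq (t := p + 1) (r := N - (p + 1) * q)]
  · omega
  · rw [show q - 1 + 1 = q by omega]; exact hr
  · rw [mul_comm] at hq1
    omega
  · omega

/-- With p = N / Q and b + 1 = N / p rounded up, N falls short of p(b + 1) by less than p. So the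
remainder is more than b + 1 - p, and p is at most n / 4, small against b + 1 ≥ 2n. -/
theorem exists_le_two_mul_lastRemainder {n Q : ℕ} (hn : 1 ≤ n) (hQ : 2 * n ≤ Q)
    (hQN : Q ≤ n.choose 2) :
    ∃ b, Q ≤ b + 1 ∧ b + 1 ≤ 2 * Q ∧ b + 1 ≤ 2 * lastRemainder n b := by
  have hN := two_mul_choose_two_le n
  set N := n.choose 2
  have ht1 : N / Q * Q ≤ N := Nat.div_mul_le_self N Q
  have ht2 : N < Q * (N / Q + 1) := Nat.lt_mul_div_succ N (by omega)
  have hp : 1 ≤ N / Q := (Nat.one_le_div_iff (by omega)).2 hQN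
  set p := N / Q
  have hpn : 4 * p ≤ n := by
    have h1 : p * (2 * n) ≤ p * Q := Nat.mul_le_mul_left _ hQ
    have h2 : 4 * p * n ≤ n * n := by nlinarith
    exact Nat.le_of_mul_le_mul_right h2 (by omega)
  obtain ⟨t, ht⟩ : ∃ t, p = t + 1 := ⟨p - 1, by omega⟩
  have hq1 : (N + t) / p * p ≤ N + t := Nat.div_mul_le_self _ _
  have hq2 : N + t < p * ((N + t) / p + 1) := Nat.lt_mul_div_succ _ hp
  set q := (N + t) / p
  have hNq : N ≤ p * q := by
    rw [mul_add, mul_one] at hq2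
    omega
  have hQq : Q ≤ q := by
    exact Nat.le_of_mul_le_mul_left (show p * Q ≤ p * q by linarith) hp
  have hqQ : q ≤ 2 * Q := by
    have h1 : q * p < (2 * Q + 1) * p := by nlinarith
    have := Nat.lt_of_mul_lt_mul_right h1
    omega
  have htq : t * q + q = p * q := by rw [ht]; ring
  have hr : N = t * q + (N - t * q) := by
    have : t * q ≤ N := by
      rw [mul_comm] at hq1
      omega
    omega
  refine ⟨q - 1, by omega, by omega, ?_⟩
  rw [mul_comm] at hq1
  rw [lastRemainder_eq (t := t) (r := N - t * q)]
  · omega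
  · rw [show q - 1 + 1 = q by omega]; exact hr
  · omega
  · omega

/-! ### Asymptotics -/

theorem eventually_mul_rpow_le {a b : ℝ} (hab : a < b) (C : ℝ) :
    ∀ᶠ n : ℕ in atTop, C * (n : ℝ) ^ a ≤ (n : ℝ) ^ b := by
  have h := (tendsto_rpow_atTop (sub_pos.2 hab)).comp tendsto_natCast_atTop_atTop
  filter_upwards [h.eventually_ge_atTop C, eventually_gt_atTop 0] with n hn hn0
  have hpos : (0 : ℝ) < n := by exact_mod_cast hn0
  have hsplit : (n : ℝ) ^ b = (n : ℝ) ^ (b - a) * (n : ℝ) ^ a := by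
    rw [← Real.rpow_add hpos, sub_add_cancel]
  rw [hsplit]
  exact mul_le_mul_of_nonneg_right hn (Real.rpow_nonneg hpos.le _)

section Exponents

variable {k : ℕ}

theorem rpow_div_sub_one_pow (hk : 3 ≤ k) (n : ℕ) :
    ((n : ℝ) ^ ((k : ℝ) / ((k : ℝ) - 1))) ^ (k - 1) = (n : ℝ) ^ k := by
  have hk' : ((k - 1 : ℕ) : ℝ) = (k : ℝ) - 1 := by
    push_cast [Nat.cast_sub (show 1 ≤ k by omega)]
    rfl
  have h1 : (k : ℝ) - 1 ≠ 0 := by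
    have : (3 : ℝ) ≤ k := by exact_mod_cast hk
    linarith
  rw [← Real.rpow_natCast, ← Real.rpow_mul (Nat.cast_nonneg n), hk', div_mul_cancel₀ _ h1,
    Real.rpow_natCast]

theorem rpow_add_one_div_pow (hk : 3 ≤ k) (n : ℕ) :
    ((n : ℝ) ^ (((k : ℝ) + 1) / (k : ℝ))) ^ k = (n : ℝ) ^ (k + 1) := by
  have h1 : (k : ℝ) ≠ 0 := by
    have : (3 : ℝ) ≤ k := by exact_mod_cast hk
    linarith
  rw [← Real.rpow_natCast, ← Real.rpow_mul (Nat.cast_nonneg n), div_mul_cancel₀ _ h1,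
    ← Real.rpow_natCast]
  push_cast
  rfl

theorem one_lt_add_one_div (hk : 3 ≤ k) : (1 : ℝ) < ((k : ℝ) + 1) / (k : ℝ) := by
  have : (3 : ℝ) ≤ k := by exact_mod_cast hk
  rw [lt_div_iff₀ (by linarith)]
  linarith

theorem add_one_div_lt_div_sub_one (hk : 3 ≤ k) :
    ((k : ℝ) + 1) / (k : ℝ) < (k : ℝ) / ((k : ℝ) - 1) := by
  have : (3 : ℝ) ≤ k := by exact_mod_cast hk
  rw [div_lt_div_iff₀ (by linarith) (by linarith)]
  linarith

theorem div_sub_one_le (hk : 3 ≤ k) : (k : ℝ) / ((k : ℝ) - 1) ≤ 3 / 2 := by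
  have : (3 : ℝ) ≤ k := by exact_mod_cast hk
  rw [div_le_div_iff₀ (by linarith) (by norm_num)]
  linarith

theorem avoiderWins_of_rpow_le (hk : 3 ≤ k) (rule : AERule) {n b : ℕ}
    (h : 2 * (n : ℝ) ^ ((k : ℝ) / ((k : ℝ) - 1)) ≤ b) :
    AvoiderWins rule 1 b (edgesK n) (starCopies k n) := by
  refine avoiderWins_of_pow_lt rule (by omega) ?_
  have h1 : (2 * (n : ℝ) ^ ((k : ℝ) / ((k : ℝ) - 1))) ^ (k - 1) < ((b : ℝ) + 1) ^ (k - 1) :=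
    pow_lt_pow_left₀ (by linarith) (by positivity) (by omega)
  rw [mul_pow, rpow_div_sub_one_pow hk] at h1
  exact_mod_cast h1

theorem avoiderWins_of_ceil_le (hk : 3 ≤ k) (rule : AERule) (n b : ℕ)
    (h : ⌈2 * (n : ℝ) ^ ((k : ℝ) / ((k : ℝ) - 1))⌉₊ ≤ b) :
    AvoiderWins rule 1 b (edgesK n) (starCopies k n) :=
  avoiderWins_of_rpow_le hk rule ((Nat.le_ceil _).trans (by exact_mod_cast h))

theorem isGreatest_fMon (hk : 3 ≤ k) (n : ℕ) :
    IsGreatest (monotoneThresholdSet (edgesK n) (starCopies k n)) (fMon k n) :=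
  isGreatest_monotoneThreshold (avoiderWins_of_ceil_le hk .monotone n)

theorem isGreatest_fMinus (hk : 3 ≤ k) (n : ℕ) :
    IsGreatest (lowerThresholdSet (edgesK n) (starCopies k n)) (fMinus k n) :=
  isGreatest_lowerThreshold (avoiderWins_of_ceil_le hk .strict n)

theorem isLeast_fPlus (hk : 3 ≤ k) (n : ℕ) :
    IsLeast (upperThresholdSet (edgesK n) (starCopies k n)) (fPlus k n) :=
  isLeast_upperThreshold (avoiderWins_of_ceil_le hk .strict n)

theorem fMon_le (hk : 3 ≤ k) (n : ℕ) :
    (fMon k n : ℝ) ≤ 2 * (n : ℝ) ^ ((k : ℝ) / ((k : ℝ) - 1)) := by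
  by_contra! hlt
  have hpos : 1 ≤ fMon k n := by
    have : (0 : ℝ) < fMon k n := lt_of_le_of_lt (by positivity) hlt
    exact_mod_cast this
  exact (avoiderWins_of_rpow_le hk .monotone hlt.le).not_enforcerWinsFrom
    (((isGreatest_fMon hk n).1 _ hpos).2 le_rfl)

theorem fPlus_le (hk : 3 ≤ k) (n : ℕ) :
    (fPlus k n : ℝ) ≤ 2 * (n : ℝ) ^ ((k : ℝ) / ((k : ℝ) - 1)) + 1 := by
  have h1 : fPlus k n ≤ ⌈2 * (n : ℝ) ^ ((k : ℝ) / ((k : ℝ) - 1))⌉₊ :=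
    (isLeast_fPlus hk n).2 fun b hb => avoiderWins_of_ceil_le hk .strict n b hb.le
  have h2 := Nat.ceil_lt_add_one (show 0 ≤ 2 * (n : ℝ) ^ ((k : ℝ) / ((k : ℝ) - 1)) by positivity)
  have h3 : (fPlus k n : ℝ) ≤ (⌈2 * (n : ℝ) ^ ((k : ℝ) / ((k : ℝ) - 1))⌉₊ : ℝ) := by
    exact_mod_cast h1
  linarith

theorem mul_rpow_floor_pow_le (hk : 3 ≤ k) {n : ℕ} {c x : ℝ} (hx : 0 ≤ x)
    (h : x ≤ c * (n : ℝ) ^ ((k : ℝ) / ((k : ℝ) - 1))) :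
    x ^ (k - 1) ≤ c ^ (k - 1) * (n : ℝ) ^ k := by
  rw [← rpow_div_sub_one_pow hk, ← mul_pow]
  exact pow_le_pow_left₀ hx h _

theorem pow_sub_one_le (hk : 3 ≤ k) {c : ℝ} (hc : 0 ≤ c) (hc1 : c ≤ 1) :
    c ^ (k - 1) ≤ c ^ 2 :=
  pow_le_pow_of_le_one hc hc1 (by omega)

/-- The factor 0.4 gives (2b)^(k-1) ≤ 0.8^(k-1) n^k ≤ 0.64 n^k, which is the hypothesis with 1.5625
= 1 / 0.64. -/
theorem eventually_enforcerWins_strict (hk : 3 ≤ k) :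
    ∀ᶠ n : ℕ in atTop, ∀ b : ℕ, 1 ≤ b →
      (b : ℝ) ≤ 0.4 * (n : ℝ) ^ ((k : ℝ) / ((k : ℝ) - 1)) →
      (lastRemainder n b : ℝ) < (n : ℝ) ^ (k + 1) / (2 * (b : ℝ)) ^ (k - 1) →
      EnforcerWins .strict 1 b (edgesK n) (starCopies k n) := by
  filter_upwards [eventually_ge_atTop
    (2 * (8 * k * (800 * k) * (8 * k * (800 * k) * 4 + 2) ^ k * (8 * k ^ 2 + 4)) + 4),
    eventually_ge_atTop (10 ^ 12 * k ^ 2), eventually_ge_atTop 1] with n hn hn' hn1 b hb hbn hr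
  have hbpos : (0 : ℝ) < b := by exact_mod_cast hb
  have hn1' : (1 : ℝ) ≤ n := by exact_mod_cast hn1
  refine enforcerWins_strict hk hn hn' hb ?_ ?_ ((lt_div_iff₀ (by positivity)).1 hr)
  · have h1 : (b : ℝ) ≤ (n : ℝ) ^ ((3 : ℝ) / 2) := by
      have h2 : (n : ℝ) ^ ((k : ℝ) / ((k : ℝ) - 1)) ≤ (n : ℝ) ^ ((3 : ℝ) / 2) :=
        Real.rpow_le_rpow_of_exponent_le hn1' (div_sub_one_le hk)
      have h3 : (0 : ℝ) ≤ (n : ℝ) ^ ((k : ℝ) / ((k : ℝ) - 1)) := by positivity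
      linarith
    have h2 : (b : ℝ) ^ 2 ≤ (n : ℝ) ^ 3 := by
      calc (b : ℝ) ^ 2 ≤ ((n : ℝ) ^ ((3 : ℝ) / 2)) ^ 2 := pow_le_pow_left₀ hbpos.le h1 2
        _ = (n : ℝ) ^ 3 := by
          rw [← Real.rpow_natCast, ← Real.rpow_mul (Nat.cast_nonneg n), ← Real.rpow_natCast]
          norm_num
    exact_mod_cast h2
  · have h1 := mul_rpow_floor_pow_le hk (n := n) (c := 0.8) (x := 2 * (b : ℝ)) (by positivity)
      (by linarith)
    have h2 := pow_sub_one_le hk (c := 0.8) (by norm_num) (by norm_num)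
    have h3 : (0.8 : ℝ) ^ (k - 1) * (n : ℝ) ^ k ≤ 0.8 ^ 2 * (n : ℝ) ^ k :=
      mul_le_mul_of_nonneg_right h2 (by positivity)
    linarith

theorem bddAbove_ePlusSet (k n : ℕ) : BddAbove (ePlusSet k n) :=
  ⟨⌊0.4 * (n : ℝ) ^ ((k : ℝ) / ((k : ℝ) - 1))⌋₊, fun _ hb => Nat.le_floor hb.2.1⟩

theorem bddAbove_eMinusSet (k n : ℕ) : BddAbove (eMinusSet k n) :=
  ⟨⌊0.4 * (n : ℝ) ^ ((k : ℝ) / ((k : ℝ) - 1))⌋₊, fun _ hb => Nat.le_floor hb.2.1⟩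

theorem eMinusSet_subset_ePlusSet (k n : ℕ) : eMinusSet k n ⊆ ePlusSet k n :=
  fun b hb => ⟨hb.1, hb.2.1, hb.2.2 b hb.1 le_rfl⟩

/-- All biases up to `n ^ ((k + 1) / k) / 4` satisfy the condition on the last remainder. -/
theorem eventually_mem_eMinusSet (hk : 3 ≤ k) :
    ∀ᶠ n : ℕ in atTop, ∀ b : ℕ, 1 ≤ b →
      (b : ℝ) ≤ 1 / 4 * (n : ℝ) ^ (((k : ℝ) + 1) / (k : ℝ)) → b ∈ eMinusSet k n := by
  filter_upwards [eventually_ge_atTop 1] with n hn b hb hbn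
  have hn1 : (1 : ℝ) ≤ n := by exact_mod_cast hn
  have hle : (n : ℝ) ^ (((k : ℝ) + 1) / (k : ℝ)) ≤ (n : ℝ) ^ ((k : ℝ) / ((k : ℝ) - 1)) :=
    Real.rpow_le_rpow_of_exponent_le hn1 (add_one_div_lt_div_sub_one hk).le
  have hpos : (0 : ℝ) < (n : ℝ) ^ (((k : ℝ) + 1) / (k : ℝ)) := Real.rpow_pos_of_pos (by linarith) _
  refine ⟨hb, by linarith, fun b' hb' hbb' => ?_⟩
  have hb'1 : (1 : ℝ) ≤ b' := by exact_mod_cast hb'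
  have hb'b : (b' : ℝ) ≤ b := by exact_mod_cast hbb'
  rw [lt_div_iff₀ (by positivity), ← rpow_add_one_div_pow hk]
  have h1 : (lastRemainder n b' : ℝ) ≤ 2 * b' := by
    have := (lastRemainder_spec n b').2.1
    have h2 : lastRemainder n b' ≤ 2 * b' := by omega
    exact_mod_cast h2
  calc (lastRemainder n b' : ℝ) * (2 * (b' : ℝ)) ^ (k - 1)
      ≤ 2 * b' * (2 * (b' : ℝ)) ^ (k - 1) := mul_le_mul_of_nonneg_right h1 (by positivity)
    _ = (2 * (b' : ℝ)) ^ k := by rw [← pow_succ', Nat.sub_add_cancel (by omega)]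
    _ < _ := pow_lt_pow_left₀ (by linarith) (by positivity) (by omega)

theorem eventually_isGreatest_eMinus (hk : 3 ≤ k) :
    ∀ᶠ n : ℕ in atTop, IsGreatest (eMinusSet k n) (eMinus k n) := by
  filter_upwards [eventually_mem_eMinusSet hk,
    eventually_mul_rpow_le ((zero_lt_one).trans (one_lt_add_one_div hk)) 4] with n h1 h2
  rw [Real.rpow_zero] at h2
  have hmem := h1 1 le_rfl (by push_cast; linarith)
  exact ⟨Nat.sSup_mem ⟨1, hmem⟩ (bddAbove_eMinusSet k n),
    fun b hb => le_csSup (bddAbove_eMinusSet k n) hb⟩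

theorem eventually_isGreatest_ePlus (hk : 3 ≤ k) :
    ∀ᶠ n : ℕ in atTop, IsGreatest (ePlusSet k n) (ePlus k n) := by
  filter_upwards [eventually_isGreatest_eMinus hk] with n h
  exact ⟨Nat.sSup_mem ⟨_, eMinusSet_subset_ePlusSet k n h.1⟩ (bddAbove_ePlusSet k n),
    fun b hb => le_csSup (bddAbove_ePlusSet k n) hb⟩

theorem eventually_ePlus_le_fPlus (hk : 3 ≤ k) : ∀ᶠ n : ℕ in atTop, ePlus k n ≤ fPlus k n := by
  filter_upwards [eventually_isGreatest_ePlus hk, eventually_enforcerWins_strict hk] with n h1 h2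
  by_contra! hlt
  obtain ⟨h3, h4, h5⟩ := h1.1
  exact ((isLeast_fPlus hk n).1 _ hlt).not_enforcerWinsFrom (h2 _ h3 h4 h5)

theorem eventually_eMinus_le_fMinus (hk : 3 ≤ k) :
    ∀ᶠ n : ℕ in atTop, eMinus k n ≤ fMinus k n := by
  filter_upwards [eventually_isGreatest_eMinus hk, eventually_enforcerWins_strict hk] with n h1 h2
  obtain ⟨h3, h4, h5⟩ := h1.1
  refine (isGreatest_fMinus hk n).2 fun b hb hbe => h2 b hb ?_ (h5 b hb hbe)
  exact (Nat.cast_le.2 hbe).trans h4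

theorem eventually_le_eMinus (hk : 3 ≤ k) :
    ∀ᶠ n : ℕ in atTop, (n : ℝ) ^ (((k : ℝ) + 1) / (k : ℝ)) ≤ 8 * eMinus k n := by
  filter_upwards [eventually_mem_eMinusSet hk,
    eventually_mul_rpow_le ((zero_lt_one).trans (one_lt_add_one_div hk)) 8] with n h1 h2
  rw [Real.rpow_zero] at h2
  set K := (n : ℝ) ^ (((k : ℝ) + 1) / (k : ℝ))
  have h3 : ⌊1 / 4 * K⌋₊ ∈ eMinusSet k n :=
    h1 _ (Nat.le_floor (by push_cast; linarith)) (Nat.floor_le (by linarith))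
  have h4 : (⌊1 / 4 * K⌋₊ : ℝ) ≤ eMinus k n := by
    exact_mod_cast le_csSup (bddAbove_eMinusSet k n) h3
  have h5 := Nat.lt_floor_add_one (1 / 4 * K)
  linarith

theorem eventually_le_choose_two {c a : ℝ} (ha : a < 2) :
    ∀ᶠ n : ℕ in atTop, c * (n : ℝ) ^ a ≤ n.choose 2 := by
  filter_upwards [eventually_mul_rpow_le ha (4 * c), eventually_ge_atTop 2] with n h1 h2
  rw [Real.rpow_two] at h1
  have h3 : n ^ 2 ≤ 4 * n.choose 2 := by
    have h4 := two_mul_choose_two n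
    have h5 : n * n ≤ n * (2 * (n - 1)) := Nat.mul_le_mul_left _ (by omega)
    nlinarith
  have h4 : (n : ℝ) ^ 2 ≤ 4 * n.choose 2 := by exact_mod_cast h3
  linarith

/-- A remainder below n suffices, because (2b)^(k-1) ≤ n^k throughout the allowed range. -/
theorem eventually_le_ePlus (hk : 3 ≤ k) :
    ∀ᶠ n : ℕ in atTop, (n : ℝ) ^ ((k : ℝ) / ((k : ℝ) - 1)) ≤ 20 * ePlus k n := by
  have hκ1 := (one_lt_add_one_div hk).trans (add_one_div_lt_div_sub_one hk)
  have hκ2 : (k : ℝ) / ((k : ℝ) - 1) < 2 := (div_sub_one_le hk).trans_lt (by norm_num)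
  filter_upwards [eventually_ge_atTop 4, eventually_mul_rpow_le hκ1 1000,
    eventually_le_choose_two (c := 1) hκ2] with n h1 h2 h3
  rw [Real.rpow_one] at h2
  have h1' : (4 : ℝ) ≤ n := by exact_mod_cast h1
  set K := (n : ℝ) ^ ((k : ℝ) / ((k : ℝ) - 1)) with hK
  have hQ1 := Nat.floor_le (show 0 ≤ 0.4 * K by linarith)
  have hQ2 := Nat.lt_floor_add_one (0.4 * K)
  obtain ⟨b, hb1, hb2, hb3, hb4⟩ := exists_lastRemainder_lt (n := n) (Q := ⌊0.4 * K⌋₊) h1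
    (Nat.le_floor (by push_cast; linarith)) (by
      have : (⌊0.4 * K⌋₊ : ℝ) ≤ n.choose 2 := by linarith
      exact_mod_cast this)
  have hb1' : (⌊0.4 * K⌋₊ : ℝ) ≤ 4 * b + 8 := by exact_mod_cast hb1
  have hb2' : (b : ℝ) + 1 ≤ ⌊0.4 * K⌋₊ := by exact_mod_cast hb2
  have hb3' : (1 : ℝ) ≤ b := by exact_mod_cast hb3
  have hb4' : (lastRemainder n b : ℝ) < n := by exact_mod_cast hb4
  have hmem : b ∈ ePlusSet k n := by
    refine ⟨hb3, by linarith, (lt_div_iff₀ (by positivity)).2 ?_⟩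
    have h4 := mul_rpow_floor_pow_le hk (n := n) (c := 1) (x := 2 * (b : ℝ)) (by positivity)
      (by linarith)
    rw [one_pow, one_mul] at h4
    calc (lastRemainder n b : ℝ) * (2 * (b : ℝ)) ^ (k - 1) < n * (2 * (b : ℝ)) ^ (k - 1) :=
          mul_lt_mul_of_pos_right hb4' (by positivity)
      _ ≤ n * (n : ℝ) ^ k := mul_le_mul_of_nonneg_left h4 (by positivity)
      _ = (n : ℝ) ^ (k + 1) := by rw [pow_succ']
  have h5 : (b : ℝ) ≤ ePlus k n := by exact_mod_cast le_csSup (bddAbove_ePlusSet k n) hmem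
  linarith

theorem eventually_fMinus_le (hk : 3 ≤ k) :
    ∀ᶠ n : ℕ in atTop, (fMinus k n : ℝ) ≤ 6 * (n : ℝ) ^ (((k : ℝ) + 1) / (k : ℝ)) := by
  have hγ2 : ((k : ℝ) + 1) / (k : ℝ) < 2 :=
    (add_one_div_lt_div_sub_one hk).trans_le ((div_sub_one_le hk).trans (by norm_num))
  filter_upwards [eventually_ge_atTop 4, eventually_mul_rpow_le (one_lt_add_one_div hk) 10,
    eventually_le_choose_two (c := 3) hγ2] with n h1 h2 h3
  rw [Real.rpow_one] at h2
  have h1' : (4 : ℝ) ≤ n := by exact_mod_cast h1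
  set K := (n : ℝ) ^ (((k : ℝ) + 1) / (k : ℝ)) with hK
  have hQ1 := Nat.floor_le (show 0 ≤ 2 * K by linarith)
  have hQ2 := Nat.lt_floor_add_one (2 * K)
  obtain ⟨b, hb1, hb2, hb3⟩ := exists_le_two_mul_lastRemainder (n := n) (Q := ⌊2 * K⌋₊ + 1)
    (by omega) (by
      have : (2 : ℝ) * n ≤ ⌊2 * K⌋₊ + 1 := by linarith
      exact_mod_cast this) (by
      have : (⌊2 * K⌋₊ : ℝ) + 1 ≤ n.choose 2 := by linarith
      exact_mod_cast this)
  have hb1' : (⌊2 * K⌋₊ : ℝ) + 1 ≤ b + 1 := by exact_mod_cast hb1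
  have hb2' : (b : ℝ) + 1 ≤ 2 * (⌊2 * K⌋₊ + 1) := by exact_mod_cast hb2
  have hA : AvoiderWins .strict 1 b (edgesK n) (starCopies k n) := by
    refine avoiderWins_strict_of_pow_lt (by omega) (by omega) hb3 ?_
    have h4 : (2 * K) ^ k < ((b : ℝ) + 1) ^ k :=
      pow_lt_pow_left₀ (by linarith) (by linarith) (by omega)
    rw [mul_pow, hK, rpow_add_one_div_pow hk] at h4
    exact_mod_cast h4
  have hb0 : 1 ≤ b := by
    have : (1 : ℝ) < (b : ℝ) + 1 := by linarith
    have : (0 : ℝ) < b := by linarith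
    exact_mod_cast this
  have h5 : (fMinus k n : ℝ) ≤ b := by
    exact_mod_cast le_of_mem_lowerThresholdSet hb0 hA (isGreatest_fMinus hk n).1
  linarith

theorem eventually_le_fMon (hk : 3 ≤ k) :
    ∀ᶠ n : ℕ in atTop, (n : ℝ) ^ ((k : ℝ) / ((k : ℝ) - 1)) ≤ 200 * fMon k n := by
  have hκ1 := (one_lt_add_one_div hk).trans (add_one_div_lt_div_sub_one hk)
  have hκ2 : (k : ℝ) / ((k : ℝ) - 1) < 2 := (div_sub_one_le hk).trans_lt (by norm_num)
  filter_upwards [eventually_ge_atTop (40 * k), eventually_mul_rpow_le hκ1 (1600 * k),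
    eventually_mul_rpow_le hκ2 1] with n h1 h2 h3
  rw [Real.rpow_one] at h2
  rw [Real.rpow_two] at h3
  have hn1 : (1 : ℝ) ≤ n := by
    have : 1 ≤ n := by omega
    exact_mod_cast this
  have hk1 : (3 : ℝ) ≤ k := by exact_mod_cast hk
  have hkn : (1 : ℝ) ≤ k * n := by nlinarith
  set K := (n : ℝ) ^ ((k : ℝ) / ((k : ℝ) - 1)) with hK
  have hb1 := Nat.floor_le (show 0 ≤ 0.01 * K by linarith)
  have hb2 := Nat.lt_floor_add_one (0.01 * K)
  set b := ⌊0.01 * K⌋₊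
  have hbpos : 1 ≤ b := by
    have : (0 : ℝ) < b := by linarith
    exact_mod_cast this
  have hE : EnforcerWins .monotone 1 b (edgesK n) (starCopies k n) := by
    refine enforcerWins_monotone (by omega) h1 ?_ ?_ ?_
    · have : (8 : ℝ) * k * n ≤ b := by linarith
      exact_mod_cast this
    · have : (20 : ℝ) * b ≤ n ^ 2 := by linarith
      exact_mod_cast this
    · have h4 := mul_rpow_floor_pow_le hk (n := n) (c := 0.17) (x := 17 * (b : ℝ)) (by positivity)
        (by linarith)
      have h5 := pow_sub_one_le hk (c := 0.17) (by norm_num) (by norm_num)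
      have h6 : (0 : ℝ) < (n : ℝ) ^ k := by positivity
      have h7 : (0.17 : ℝ) ^ (k - 1) * (n : ℝ) ^ k ≤ 0.17 ^ 2 * (n : ℝ) ^ k :=
        mul_le_mul_of_nonneg_right h5 h6.le
      have h8 : (17 * (b : ℝ)) ^ (k - 1) * 3 < (n : ℝ) ^ k := by linarith
      exact_mod_cast h8
  have h4 : (b : ℝ) ≤ fMon k n := by
    exact_mod_cast ((isGreatest_fMon hk n).1 b hbpos).1 hE
  linarith

end Exponents

theorem isBigO_of_eventually_le_mul {ι : Type*} {l : Filter ι} {f g : ι → ℝ} {C : ℝ}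
    (hf : ∀ᶠ x in l, 0 ≤ f x) (h : ∀ᶠ x in l, f x ≤ C * g x) : f =O[l] g := by
  refine IsBigO.of_bound |C| ?_
  filter_upwards [hf, h] with x h1 h2
  rw [Real.norm_of_nonneg h1, Real.norm_eq_abs, ← abs_mul]
  exact h2.trans (le_abs_self _)

theorem theorem1 (k : ℕ) (hk : 3 ≤ k) :
    -- the three threshold biases exist for every `n`, and the two maxima for every large `n`
    ((∀ n : ℕ, IsGreatest (monotoneThresholdSet (edgesK n) (starCopies k n)) (fMon k n)) ∧
      (∀ n : ℕ, IsLeast (upperThresholdSet (edgesK n) (starCopies k n)) (fPlus k n)) ∧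
      (∀ n : ℕ, IsGreatest (lowerThresholdSet (edgesK n) (starCopies k n)) (fMinus k n)) ∧
      (∀ᶠ n : ℕ in atTop, IsGreatest (ePlusSet k n) (ePlus k n)) ∧
      (∀ᶠ n : ℕ in atTop, IsGreatest (eMinusSet k n) (eMinus k n))) ∧
    -- (i)
    ((fun n : ℕ => (fMon k n : ℝ)) =Θ[atTop] fun n : ℕ => (n : ℝ) ^ ((k : ℝ) / ((k : ℝ) - 1))) ∧
    -- (ii)
    ((∀ᶠ n : ℕ in atTop, ePlus k n ≤ fPlus k n) ∧
      ((fun n : ℕ => (fPlus k n : ℝ)) =O[atTop]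
        fun n : ℕ => (n : ℝ) ^ ((k : ℝ) / ((k : ℝ) - 1))) ∧
      ∃ S : Set ℕ, S.Infinite ∧
        (fun n : ℕ => (fPlus k n : ℝ)) =Θ[atTop ⊓ 𝓟 S]
          fun n : ℕ => (n : ℝ) ^ ((k : ℝ) / ((k : ℝ) - 1))) ∧
    -- (iii)
    (((fun n : ℕ => (n : ℝ) ^ (((k : ℝ) + 1) / (k : ℝ))) =O[atTop]
        fun n : ℕ => (eMinus k n : ℝ)) ∧
      (∀ᶠ n : ℕ in atTop, eMinus k n ≤ fMinus k n) ∧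
      ((fun n : ℕ => (fMinus k n : ℝ)) =O[atTop]
        fun n : ℕ => (n : ℝ) ^ (((k : ℝ) + 1) / (k : ℝ)) * Real.log (n : ℝ)) ∧
      ∃ S : Set ℕ, S.Infinite ∧
        (fun n : ℕ => (fMinus k n : ℝ)) =Θ[atTop ⊓ 𝓟 S]
          fun n : ℕ => (n : ℝ) ^ (((k : ℝ) + 1) / (k : ℝ))) ∧
    -- the lower and the upper threshold bias are not of the same order
    ¬ ((fun n : ℕ => (fMinus k n : ℝ)) =Θ[atTop] fun n : ℕ => (fPlus k n : ℝ)) := by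
  obtain ⟨κ, hκ⟩ : ∃ κ, κ = (k : ℝ) / ((k : ℝ) - 1) := ⟨_, rfl⟩
  obtain ⟨γ, hγ⟩ : ∃ γ, γ = ((k : ℝ) + 1) / (k : ℝ) := ⟨_, rfl⟩
  have hγκ : γ < κ := by rw [hκ, hγ]; exact add_one_div_lt_div_sub_one hk
  have hγ1 : 1 < γ := by rw [hγ]; exact one_lt_add_one_div hk
  have hMonTheta : (fun n : ℕ => (fMon k n : ℝ)) =Θ[atTop] fun n : ℕ => (n : ℝ) ^ κ := by
    rw [hκ]
    exact ⟨isBigO_of_eventually_le_mul (.of_forall fun _ => by positivity)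
        (.of_forall (fMon_le hk)),
      isBigO_of_eventually_le_mul (.of_forall fun _ => by positivity) (eventually_le_fMon hk)⟩
  have hlePlus : ∀ᶠ n : ℕ in atTop, (n : ℝ) ^ κ ≤ 20 * fPlus k n := by
    rw [hκ]
    filter_upwards [eventually_le_ePlus hk, eventually_ePlus_le_fPlus hk] with n h1 h2
    have h3 : (ePlus k n : ℝ) ≤ fPlus k n := by exact_mod_cast h2
    linarith
  have hPlusTheta : (fun n : ℕ => (fPlus k n : ℝ)) =Θ[atTop] fun n : ℕ => (n : ℝ) ^ κ := by
    refine ⟨isBigO_of_eventually_le_mul (C := 3) (.of_forall fun _ => by positivity) ?_,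
      isBigO_of_eventually_le_mul (.of_forall fun _ => by positivity) hlePlus⟩
    filter_upwards [eventually_mul_rpow_le (show 0 < κ by linarith) 1] with n h1
    have h2 := fPlus_le hk n
    rw [← hκ] at h2
    rw [Real.rpow_zero] at h1
    linarith
  have hMinusTheta : (fun n : ℕ => (fMinus k n : ℝ)) =Θ[atTop] fun n : ℕ => (n : ℝ) ^ γ := by
    rw [hγ]
    refine ⟨isBigO_of_eventually_le_mul (.of_forall fun _ => by positivity)
        (eventually_fMinus_le hk),
      isBigO_of_eventually_le_mul (C := 8) (.of_forall fun _ => by positivity) ?_⟩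
    filter_upwards [eventually_le_eMinus hk, eventually_eMinus_le_fMinus hk] with n h1 h2
    have h3 : (eMinus k n : ℝ) ≤ fMinus k n := by exact_mod_cast h2
    linarith
  have hlog : (fun n : ℕ => (n : ℝ) ^ γ) =O[atTop] fun n : ℕ => (n : ℝ) ^ γ * Real.log n := by
    refine isBigO_of_eventually_le_mul (C := 1) (.of_forall fun _ => by positivity) ?_
    filter_upwards [(Real.tendsto_log_atTop.comp
      tendsto_natCast_atTop_atTop).eventually_ge_atTop 1] with n h1
    rw [one_mul]
    exact le_mul_of_one_le_right (by positivity) h1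
  have hnot : ¬ ((fun n : ℕ => (fMinus k n : ℝ)) =Θ[atTop] fun n : ℕ => (fPlus k n : ℝ)) := by
    intro h
    obtain ⟨C, hC⟩ := ((hPlusTheta.symm.trans h.symm).trans hMinusTheta).1.bound
    obtain ⟨n, h1, h2, h3⟩ := (hC.and ((eventually_mul_rpow_le hγκ (C + 1)).and
      (eventually_gt_atTop 0))).exists
    have h4 : (0 : ℝ) < (n : ℝ) ^ γ := Real.rpow_pos_of_pos (by exact_mod_cast h3) _
    rw [Real.norm_of_nonneg (by positivity), Real.norm_of_nonneg h4.le] at h1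
    linarith
  rw [← hκ, ← hγ]
  refine ⟨⟨isGreatest_fMon hk, isLeast_fPlus hk, isGreatest_fMinus hk,
      eventually_isGreatest_ePlus hk, eventually_isGreatest_eMinus hk⟩,
    hMonTheta,
    -- The order holds along all n, so the infinite set may be everything.
    ⟨eventually_ePlus_le_fPlus hk, hPlusTheta.1, Set.univ, Set.infinite_univ, ?_⟩,
    ⟨isBigO_of_eventually_le_mul (.of_forall fun _ => by positivity)
        (by rw [hγ]; exact eventually_le_eMinus hk),
      eventually_eMinus_le_fMinus hk, hMinusTheta.1.trans hlog, Set.univ, Set.infinite_univ, ?_⟩,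
    hnot⟩
  · rwa [principal_univ, inf_top_eq]
  · rwa [principal_univ, inf_top_eq]
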